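/- **Theorem (global existence of optimal solutions for $(P)$).** Let $T>0$, let $f,g:[0,T]\times\mathbb R^n\times\mathbb R^l\times\mathbb R^m\to\mathbb R^n,\ \mathbb R^l$, $h:=(f,g)$, and $\psi_1,\dots,\psi_r:[0,T]\times\mathbb R^n\to\mathbb R$ continuous. For $t\in[0,T]$ let $C(t):=\{x\in\mathbb R^n:\psi_i(t,x)\le 0,\ i=1,\dots,r\}$, assumed non-empty, and let $\mathrm{Gr}\,C:=\{(t,x):t\in[0,T],\,x\in C(t)\}$. Let $U(\cdot):[0,T]\rightsquigarrow\mathbb R^m$ be a Lebesgue measurable set-valued map with non-empty compact values, $\mathcal U$ the set of Lebesgue measurable $u:[0,T]\to\mathbb R^m$ with $u(t)\in U(t)$ a.e., $S\subset C(0)\times\mathbb R^l\times\mathbb R^n\times\mathbb R^l$ closed, and $J:\mathbb R^n\times\mathbb R^l\times\mathbb R^n\times\mathbb R^l\to\mathbb R\cup\{\infty\}$ lower semicontinuous. Norms are Euclidean, $B$ and $\bar B$ are the open and closed unit balls, and $N_{C(t)}(x)$ is the Clarke normal cone to $C(t)$ at $x$ (empty if $x\notin C(t)$). Consider the problem $$(P)\quad\text{minimize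 } J(x(0),y(0),x(T),y(T))$$ over $((x,y),u)\in W^{1,1}([0,T];\mathbb R^n\times\mathbb R^l)\times\mathcal U$ such that, for a.e. $t\in[0,T]$, $$\dot x(t)\in f(t,x(t),y(t),u(t))-N_{C(t)}(x(t)),\qquad \dot y(t)=g(t,x(t),y(t),u(t)),$$ and $(x(0),y(0),x(T),y(T))\in S$; such $((x,y),u)$ are called admissible. A global optimal solution of $(P)$ is an admissible pair with finite cost, i.e. with endpoints in $\mathrm{dom}\,J=\{J<\infty\}$, whose cost is at most that of every admissible pair. Assume: 1. There are $\rho_o>0$ and $L_\psi>0$ such that, for each $i$, $\nabla_x\psi_i$ exists on $\mathrm{Gr}\,C+\{0\}\times\rho_oB$, and for all $(t_1,x_1),(t_2,x_2)\in \mathrm{Gr}\,C+\{0\}\times\frac{\rho_o}{2}\bar B$, $$\max\{|\psi_i(t_1,x_1)-\psi_i(t_2,x_2)|,\ \|\nabla_x\psi_i(t_1,x_1)-\nabla_x\psi_i(t_2,x_2)\|\}\le L_\psi(|t_1-t_2|+\|x_1-x_2\|).$$ 2. For every $(t,x)\in\mathrm{Gr}\,C$, with $\mathcal I^0_{(t,x)}:=\{i:\psi_i(t,x)=0\}$: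 if $\lambda_i\ge0$ for $i\in\mathcal I^0_{(t,x)}$ and $\sum_{i\in\mathcal I^0_{(t,x)}}\lambda_i\nabla_x\psi_i(t,x)=0$, then $\lambda_i=0$ for all $i\in\mathcal I^0_{(t,x)}$. 3. For all $(x,y,u)\in\big(\bigcup_tC(t)\big)\times\mathbb R^l\times\big(\bigcup_tU(t)\big)$, $h(\cdot,x,y,u)$ is Lebesgue measurable on $[0,T]$; moreover, for all $(x,y)\in\mathbb R^n\times\mathbb R^l$ and all $u\in\mathcal U$, the function $t\mapsto h(t,x,y,u(t))$ is Lebesgue measurable on $\{t\in[0,T]:x\in C(t)\}$. For a.e. $t\in[0,T]$, $h(t,\cdot,\cdot,\cdot)$ is continuous on $C(t)\times\mathbb R^l\times U(t)$. There are $M_h>0$ and a non-negative $L_h\in L^2([0,T])$ such that for a.e. $t\in[0,T]$, all $(x,y),(x',y')\in C(t)\times\mathbb R^l$ and all $u\in U(t)$, $$\|h(t,x,y,u)\|\le M_h,\qquad \|h(t,x,y,u)-h(t,x',y',u)\|\le L_h(t)\,\|(x,y)-(x',y')\|.$$ 4. For a.e. $t\in[0,T]$ and all $(x,y)\in C(t)\times\mathbb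 R^l$, the set $h(t,x,y,U(t))$ is convex. 5. $\mathrm{Gr}\,C$ is bounded, and so is $\pi_2(S):=\{y_0:(x_0,y_0,x_1,y_1)\in S\}$. Then $(P)$ has a global optimal solution if and only if it has at least one admissible pair $((x,y),u)$ with $(x(0),y(0),x(T),y(T))\in\mathrm{dom}\,J$. -/

import Mathlib

open MeasureTheory Set Filter Topology

namespace SweepingControl

/-- `ℝ^k` with the Euclidean norm and inner product. -/
abbrev Vec (k : ℕ) : Type := EuclideanSpace ℝ (Fin k)

/-- The Clarke tangent cone to `A` at `s`: all `v` such that for all sequences `s_k → s` in `A` and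
`τ_k ↓ 0` there is a sequence `v_k → v` with `s_k + τ_k v_k ∈ A` for every `k`. -/
def clarkeTangentCone {k : ℕ} (A : Set (Vec k)) (s : Vec k) : Set (Vec k) :=
  {v | ∀ (a : ℕ → Vec k) (τ : ℕ → ℝ), (∀ j, a j ∈ A) → Tendsto a atTop (𝓝 s) →
    (∀ j, 0 < τ j) → Tendsto τ atTop (𝓝 0) →
    ∃ w : ℕ → Vec k, Tendsto w atTop (𝓝 v) ∧ ∀ j, a j + τ j • w j ∈ A}

/-- The Clarke normal cone to `A` at `s`: the polar of the Clarke tangent cone if `s ∈ A`, and the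
empty set if `s ∉ A`. -/
def clarkeNormalCone {k : ℕ} (A : Set (Vec k)) (s : Vec k) : Set (Vec k) :=
  {ζ | s ∈ A ∧ ∀ v ∈ clarkeTangentCone A s, inner ℝ ζ v ≤ 0}

/-- `z` belongs to `W^{1,1}([0,T]; ℝ^k)` and `z'` is (a representative of) its derivative. -/
def HasW11Deriv {k : ℕ} (T : ℝ) (z z' : ℝ → Vec k) : Prop :=
  IntegrableOn z' (Icc 0 T) ∧ ∀ t ∈ Icc 0 T, z t = z 0 + ∫ s in (0 : ℝ)..t, z' s

/-- The data of the Mayer problem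
minimize `J (x 0, y 0, x T, y T)` subject to `x' ∈ f (t,x,y,u) - N_{C(t)}(x)`,
`y' = g (t,x,y,u)`, `u ∈ U`, `(x 0, y 0, x T, y T) ∈ S`, where `C(t) = {x | ψ_i (t,x) ≤ 0 ∀ i}`.
Only the values at times in `[0,T]` are used. -/
structure Problem (n l m r : ℕ) where
  /-- final time -/
  T : ℝ
  /-- perturbation of the sweeping process -/
  f : ℝ → Vec n → Vec l → Vec m → Vec n
  /-- right-hand side of the differential equation -/
  g : ℝ → Vec n → Vec l → Vec m → Vec l
  /-- generators of the sweeping sets -/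
  ψ : Fin r → ℝ → Vec n → ℝ
  /-- control constraint -/
  U : ℝ → Set (Vec m)
  /-- constraint on the joint endpoints -/
  S : Set (Vec n × Vec l × Vec n × Vec l)
  /-- cost -/
  J : Vec n × Vec l × Vec n × Vec l → WithTop ℝ

namespace Problem

variable {n l m r : ℕ} (P : Problem n l m r)

/-- Lebesgue measure on `[0,T]`. -/
noncomputable def timeMeasure : Measure ℝ := volume.restrict (Icc 0 P.T)

/-- The sweeping set `C(t)`. -/
def C (t : ℝ) : Set (Vec n) := {x | ∀ i, P.ψ i t x ≤ 0}

/-- The graph of `C(·)` over `[0,T]`. -/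
def graphC : Set (ℝ × Vec n) := {p | p.1 ∈ Icc 0 P.T ∧ p.2 ∈ P.C p.1}

/-- `h = (f,g)`, with the Euclidean norm on `ℝ^n × ℝ^l`. -/
def h (t : ℝ) (x : Vec n) (y : Vec l) (u : Vec m) : WithLp 2 (Vec n × Vec l) :=
  WithLp.toLp 2 (P.f t x y u, P.g t x y u)

/-- The set of control functions: Lebesgue measurable `u` with `u(t) ∈ U(t)` a.e. in `[0,T]`. -/
def controls : Set (ℝ → Vec m) :=
  {u | AEMeasurable u P.timeMeasure ∧ ∀ᵐ t ∂P.timeMeasure, u t ∈ P.U t}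

/-- The endpoints `(x 0, y 0, x T, y T)`. -/
def endpoints (x : ℝ → Vec n) (y : ℝ → Vec l) : Vec n × Vec l × Vec n × Vec l :=
  (x 0, y 0, x P.T, y P.T)

/-- The effective domain of `J`. -/
def domJ : Set (Vec n × Vec l × Vec n × Vec l) := {p | P.J p < ⊤}

/-- `((x,y),u)` satisfies the dynamic: the controlled sweeping process for `x` coupled with the
controlled differential equation for `y`. -/
def SolvesDynamics (x : ℝ → Vec n) (y : ℝ → Vec l) (u : ℝ → Vec m) : Prop :=
  ∃ (x' : ℝ → Vec n) (y' : ℝ → Vec l), HasW11Deriv P.T x x' ∧ HasW11Deriv P.T y y' ∧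
    (∀ᵐ t ∂P.timeMeasure,
      ∃ ν ∈ clarkeNormalCone (P.C t) (x t), x' t = P.f t (x t) (y t) (u t) - ν) ∧
    (∀ᵐ t ∂P.timeMeasure, y' t = P.g t (x t) (y t) (u t))

/-- Admissible pairs `((x,y),u)`. -/
def Admissible (x : ℝ → Vec n) (y : ℝ → Vec l) (u : ℝ → Vec m) : Prop :=
  u ∈ P.controls ∧ P.SolvesDynamics x y u ∧ P.endpoints x y ∈ P.S

/-- Global optimal solutions: admissible pairs of finite cost that minimize the cost among all
admissible pairs. -/
def IsGlobalOptimal (x : ℝ → Vec n) (y : ℝ → Vec l) (u : ℝ → Vec m) : Prop :=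
  P.Admissible x y u ∧ P.endpoints x y ∈ P.domJ ∧
    ∀ (x₁ : ℝ → Vec n) (y₁ : ℝ → Vec l) (u₁ : ℝ → Vec m), P.Admissible x₁ y₁ u₁ →
      P.J (P.endpoints x y) ≤ P.J (P.endpoints x₁ y₁)

/-- `U(·)` is a Lebesgue measurable set-valued map on `[0,T]`. -/
def MeasurableControlSets : Prop :=
  ∀ O : Set (Vec m), IsOpen O → NullMeasurableSet {t | t ∈ Icc 0 P.T ∧ (P.U t ∩ O).Nonempty} volume

/-- Global regularity of the generators: for some `ρ, L > 0`, the gradients `∇_x ψ_i` exist on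
`Gr C(·) + {0} × ρ B`, and `ψ_i`, `∇_x ψ_i` are `L`-Lipschitz on
`Gr C(·) + {0} × (ρ/2) B̄`. -/
def RegularGenerators : Prop :=
  ∃ ρ > 0, ∃ L > 0, ∀ i,
    (∀ t x c, (t, c) ∈ P.graphC → ‖x - c‖ < ρ → DifferentiableAt ℝ (P.ψ i t) x) ∧
    (∀ t₁ x₁ c₁ t₂ x₂ c₂, (t₁, c₁) ∈ P.graphC → ‖x₁ - c₁‖ ≤ ρ / 2 →
      (t₂, c₂) ∈ P.graphC → ‖x₂ - c₂‖ ≤ ρ / 2 →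
      max |P.ψ i t₁ x₁ - P.ψ i t₂ x₂| ‖gradient (P.ψ i t₁) x₁ - gradient (P.ψ i t₂) x₂‖
        ≤ L * (|t₁ - t₂| + ‖x₁ - x₂‖))

/-- Global constraint qualification: the gradients of the active generators are positively linearly
independent at every point of the graph of `C(·)`. -/
def ConstraintQualification : Prop :=
  ∀ t x, (t, x) ∈ P.graphC → ∀ c : Fin r → ℝ, (∀ i, P.ψ i t x = 0 → 0 ≤ c i) →
    ∑ i with P.ψ i t x = 0, c i • gradient (P.ψ i t) x = 0 → ∀ i, P.ψ i t x = 0 → c i = 0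

/-- Global regularity of `h = (f,g)`: measurability in `t`, continuity in `(x,y,u)`, boundedness,
and Lipschitz continuity in `(x,y)` with an `L²` modulus. The second condition, measurability of
`t ↦ h (t,x,y,u(t))` on `{t | x ∈ C(t)}` for every control function `u`, follows from the first and
the third if `U(·)` is constant. -/
def RegularDynamics : Prop :=
  (∀ x ∈ ⋃ t ∈ Icc 0 P.T, P.C t, ∀ y, ∀ u ∈ ⋃ t ∈ Icc 0 P.T, P.U t,
    AEMeasurable (fun t => P.h t x y u) P.timeMeasure) ∧
  (∀ x y, ∀ u ∈ P.controls, AEMeasurable (fun t => P.h t x y (u t))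
    (volume.restrict {t | (t, x) ∈ P.graphC})) ∧
  (∀ᵐ t ∂P.timeMeasure, ContinuousOn (fun q : Vec n × Vec l × Vec m => P.h t q.1 q.2.1 q.2.2)
    (P.C t ×ˢ univ ×ˢ P.U t)) ∧
  ∃ M > 0, ∃ Λ : ℝ → ℝ, (∀ t ∈ Icc 0 P.T, 0 ≤ Λ t) ∧ MemLp Λ 2 P.timeMeasure ∧
    ∀ᵐ t ∂P.timeMeasure, ∀ x ∈ P.C t, ∀ y, ∀ x₁ ∈ P.C t, ∀ y₁, ∀ u ∈ P.U t,
      ‖P.h t x y u‖ ≤ M ∧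
      ‖P.h t x y u - P.h t x₁ y₁ u‖ ≤
        Λ t * ‖(WithLp.toLp 2 (x, y) - WithLp.toLp 2 (x₁, y₁) : WithLp 2 (Vec n × Vec l))‖

/-- For a.e. `t`, the sets `h (t,x,y,U(t))` with `x ∈ C(t)` are convex. -/
def ConvexVelocities : Prop :=
  ∀ᵐ t ∂P.timeMeasure, ∀ x ∈ P.C t, ∀ y, Convex ℝ (P.h t x y '' P.U t)

end Problem

end SweepingControl

/-!
Only existence under the condition `∃ admissible pair of finite cost` needs an argument, and it
follows from one fact: the set of endpoints of admissible pairs is compact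
(`IsRegular.isCompact_endpoints`), so that a lower semicontinuous cost attains its minimum on it.

**A priori bounds.** By Gordan's theorem the constraint qualification provides, at each point of the
graph of `C(·)`, a direction along which all active generators decrease, and compactness of the
graph makes the rate uniform (`exists_isInward`). Such directions are Clarke tangent, and adding a
multiple of one to an arbitrary vector turns the polarity defining the normal cone into a
quantitative inequality (`inner_le_of_mem_clarkeNormalCone`). Tested with the velocity of a
trajectory it bounds the normal vectors `ν = f - x'` (`norm_le_of_hasDerivAt`); tested with `c - x`
it gives the hypomonotonicity `⟪ν, c - x⟫ ≤ κ ‖c - x‖²` of the normal cones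
(`inner_sub_le_of_mem_clarkeNormalCone`). No multiplier representation of normal vectors is used.

**Passage to the limit.** Trajectories and the primitives of their velocities `h` are
equi-Lipschitz, so a subsequence converges pointwise, by Arzelà–Ascoli. No weak topologies are
needed: inequalities are integrated over intervals, passed to the limit along the primitives, and
differentiated again at almost every time. This yields

* `z' ∈ h (t, x, y, U(t))` for the limit `z` of the primitives (`mem_of_tendsto_integral`,
  `IsRegular.ae_mem_image`), using convexity of the velocity sets; a control realizing `z'` is
  found by Filippov's lemma (`exists_control_eq`), which rests on the Kuratowski–Ryll-Nardzewski
  selection theorem;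
* `f - x' ∈ N_{C(t)}(x)` (`IsRegular.mem_clarkeNormalCone_of_tendsto`), because the
  hypomonotonicity inequality survives the limit and, tested along Clarke tangent vectors,
  characterizes normality. It needs to be tested only with points where every generator is negative,
  which stay in `C(s)` for nearby times `s` and are dense in `C(t)`.
-/

namespace SweepingControl

/-! ### Lipschitz curves on an interval -/

theorem eq_add_integral_deriv_of_lipschitzOnWith {F : Type*} [NormedAddCommGroup F] [NormedSpace ℝ F]
    [FiniteDimensional ℝ F] {f : ℝ → F} {K : NNReal} {T : ℝ} (hT : 0 ≤ T)
    (hf : LipschitzOnWith K f (Icc 0 T)) :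
    IntegrableOn (deriv f) (Icc 0 T) ∧
      (∀ t ∈ Icc 0 T, f t = f 0 + ∫ s in (0 : ℝ)..t, deriv f s) ∧
      (∀ᵐ t ∂volume.restrict (Icc 0 T), HasDerivAt f (deriv f t) t) := by
  have : CompleteSpace F := FiniteDimensional.complete ℝ F
  have h0 : ∀ᵐ x : ℝ, x ≠ 0 := by simp [ae_iff, measure_singleton]
  have h1 : ∀ᵐ x : ℝ, x ≠ T := by simp [ae_iff, measure_singleton]
  have hnhds : ∀ x ∈ Icc 0 T, x ≠ 0 → x ≠ T → Icc 0 T ∈ 𝓝 x := fun x hx hx0 hx1 =>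
    Icc_mem_nhds (lt_of_le_of_ne hx.1 (Ne.symm hx0)) (lt_of_le_of_ne hx.2 hx1)
  have hder : ∀ᵐ t, t ∈ Icc 0 T → HasDerivAt f (deriv f t) t := by
    filter_upwards [hf.ae_differentiableWithinAt_of_mem_real, h0, h1] with x hx hx0 hx1 hxs
    exact ((hx hxs).differentiableAt (hnhds x hxs hx0 hx1)).hasDerivAt
  have hint : IntegrableOn (deriv f) (Icc 0 T) := by
    refine Measure.integrableOn_of_bounded (M := K) measure_Icc_lt_top.ne
      (aestronglyMeasurable_deriv f _) ?_
    rw [ae_restrict_iff' measurableSet_Icc]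
    filter_upwards [h0, h1] with x hx0 hx1 hxs
    exact norm_deriv_le_of_lipschitzOn (hnhds x hxs hx0 hx1) hf
  refine ⟨hint, ?_, (ae_restrict_iff' measurableSet_Icc).2 hder⟩
  have hii : IntervalIntegrable (deriv f) volume 0 T :=
    (intervalIntegrable_iff_integrableOn_Icc_of_le hT).2 hint
  -- the primitive of the bounded function `deriv f` is Lipschitz
  have hprim : LipschitzOnWith K (fun t => ∫ s in (0 : ℝ)..t, deriv f s) (Icc 0 T) := by
    refine LipschitzOnWith.of_dist_le_mul fun a ha b hb => ?_
    have hab : ∀ c ∈ Icc 0 T, IntervalIntegrable (deriv f) volume 0 c := fun c hc =>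
      hii.mono_set (by rw [uIcc_of_le hc.1, uIcc_of_le hT]; exact Icc_subset_Icc_right hc.2)
    rw [dist_eq_norm, intervalIntegral.integral_interval_sub_left (hab a ha) (hab b hb),
      Real.dist_eq]
    refine intervalIntegral.norm_integral_le_of_norm_le_const_ae ?_
    filter_upwards [h0, h1] with x hx0 hx1 hxs
    have hx : x ∈ Icc 0 T := uIcc_subset_Icc hb ha (uIoc_subset_uIcc hxs)
    exact norm_deriv_le_of_lipschitzOn (hnhds x hx hx0 hx1) hf
  have hac : AbsolutelyContinuousOnInterval (fun t => f t - ∫ s in (0 : ℝ)..t, deriv f s) 0 T := by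
    rw [← uIcc_of_le hT] at hf hprim
    exact hf.absolutelyContinuousOnInterval.fun_sub hprim.absolutelyContinuousOnInterval
  obtain ⟨c, hc⟩ := hac.const_of_ae_hasDerivAt_zero (by
    filter_upwards [hder, hii.ae_hasDerivAt_integral] with x hx hx' hxs
    have := (hx (by rwa [uIcc_of_le hT] at hxs)).fun_sub (hx' hxs 0 (by simp))
    simpa using this)
  rw [uIcc_of_le hT] at hc
  intro t ht
  have e0 := hc 0 (by simp [hT])
  have et := hc t ht
  simp only [intervalIntegral.integral_same, sub_zero] at e0
  rw [e0, ← et]; abel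

/-- A sequential form of the Arzelà–Ascoli theorem for equi-Lipschitz curves. -/
theorem exists_subseq_tendsto_of_lipschitzOnWith {E : Type*} [NormedAddCommGroup E]
    [ProperSpace E] {K : NNReal} {R T : ℝ} (hT : 0 ≤ T) {F : ℕ → ℝ → E}
    (hK : ∀ j, LipschitzOnWith K (F j) (Icc 0 T)) (hR : ∀ j, ∀ t ∈ Icc 0 T, ‖F j t‖ ≤ R) :
    ∃ φ : ℕ → ℕ, StrictMono φ ∧ ∃ G : ℝ → E, LipschitzOnWith K G (Icc 0 T) ∧
      ∀ t ∈ Icc 0 T, Tendsto (fun j => F (φ j) t) atTop (𝓝 (G t)) := by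
  let A : Set (BoundedContinuousFunction (Icc 0 T) E) :=
    (⋂ (a) (b), {g | dist (g a) (g b) ≤ K * dist a b}) ∩ ⋂ a, {g | ‖g a‖ ≤ R}
  have hA_iff : ∀ g, g ∈ A ↔ LipschitzWith K g ∧ ∀ t, ‖g t‖ ≤ R := fun g => by
    simp only [A, mem_inter_iff, mem_iInter, mem_ofPred_eq, lipschitzWith_iff_dist_le_mul]
  have hev : ∀ a : Icc 0 T, Continuous fun g : BoundedContinuousFunction (Icc 0 T) E => g a :=
    fun a => (continuous_apply a).comp BoundedContinuousFunction.continuous_coe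
  have hA : IsCompact A := by
    refine BoundedContinuousFunction.arzela_ascoli₂ (Metric.closedBall 0 R)
      (isCompact_closedBall 0 R) A ?_ (fun g t hg => by simpa using ((hA_iff g).1 hg).2 t) ?_
    · exact (isClosed_iInter fun a => isClosed_iInter fun b =>
        isClosed_le ((hev a).dist (hev b)) continuous_const).inter
        (isClosed_iInter fun a => isClosed_le (hev a).norm continuous_const)
    · exact (LipschitzWith.uniformEquicontinuous _ K
        fun g : A => ((hA_iff g).1 g.2).1).equicontinuous
  let g : ℕ → BoundedContinuousFunction (Icc 0 T) E := fun j =>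
    BoundedContinuousFunction.mkOfCompact
      ⟨(Icc 0 T).domRestrict (F j), (hK j).continuousOn.domRestrict⟩
  have hg : ∀ j, g j ∈ A := fun j =>
    (hA_iff _).2 ⟨lipschitzOnWith_iff_restrict.1 (hK j), fun t => hR j t t.2⟩
  obtain ⟨G, hG, φ, hφ, hlim⟩ := hA.tendsto_subseq hg
  refine ⟨φ, hφ, IccExtend hT G, ?_, fun t ht => ?_⟩
  · rw [lipschitzOnWith_iff_restrict]
    have : (Icc 0 T).domRestrict (IccExtend hT G) = G := by
      ext t; simp
    rw [this]; exact ((hA_iff G).1 hG).1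
  · have h1 := ((hev ⟨t, ht⟩).tendsto G).comp hlim
    rw [IccExtend_of_mem hT _ ht]
    exact h1

/-! ### Measurable selections -/

/-- The Kuratowski–Ryll-Nardzewski selection theorem. -/
theorem exists_measurable_selection {α E : Type*} [MeasurableSpace α] [MetricSpace E]
    [CompleteSpace E] [SecondCountableTopology E] [Nonempty E] [MeasurableSpace E] [BorelSpace E]
    {W : α → Set E} (hne : ∀ t, (W t).Nonempty) (hcl : ∀ t, IsClosed (W t))
    (hmeas : ∀ O, IsOpen O → MeasurableSet {t | (W t ∩ O).Nonempty}) :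
    ∃ w : α → E, Measurable w ∧ ∀ t, w t ∈ W t := by
  classical
  let q := TopologicalSpace.denseSeq E
  have hq : ∀ (e : E) (r : ℝ), 0 < r → ∃ i, dist e (q i) < r := fun e _ hr =>
    (TopologicalSpace.denseRange_denseSeq E).exists_dist_lt e hr
  let Q : ℕ → (α → E) → Prop := fun k w =>
    Measurable w ∧ ∀ t, (W t ∩ Metric.ball (w t) ((1 / 2) ^ k)).Nonempty
  have h0 : ∃ w, Q 0 w := by
    have hex : ∀ t, ∃ i, (W t ∩ Metric.ball (q i) 1).Nonempty := fun t => by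
      obtain ⟨e, he⟩ := hne t
      obtain ⟨i, hi⟩ := hq e 1 one_pos
      exact ⟨i, e, he, hi⟩
    refine ⟨fun t => q (Nat.find (hex t)), ?_, fun t => by simpa using Nat.find_spec (hex t)⟩
    exact (measurable_from_nat (f := q)).comp
      (measurable_find hex fun k => hmeas _ Metric.isOpen_ball)
  have step : ∀ k w, Q k w → ∃ w', Q (k + 1) w' ∧ ∀ t, dist (w t) (w' t) ≤ 2 * (1 / 2) ^ k := by
    intro k w hw
    have hpos : (0 : ℝ) < (1 / 2) ^ (k + 1) := by positivity
    have hex : ∀ t, ∃ i, (W t ∩ Metric.ball (q i) ((1 / 2) ^ (k + 1))).Nonempty ∧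
        dist (w t) (q i) ≤ 2 * (1 / 2) ^ k := fun t => by
      obtain ⟨e, he, he'⟩ := hw.2 t
      obtain ⟨i, hi⟩ := hq e _ hpos
      refine ⟨i, ⟨e, he, hi⟩, ?_⟩
      have h1 : dist e (w t) < (1 / 2) ^ k := he'
      have h2 := dist_triangle_left (w t) (q i) e
      rw [pow_succ] at hi hpos
      linarith
    refine ⟨fun t => q (Nat.find (hex t)), ⟨?_, fun t => (Nat.find_spec (hex t)).1⟩,
      fun t => (Nat.find_spec (hex t)).2⟩
    refine (measurable_from_nat (f := q)).comp (measurable_find hex fun i => ?_)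
    exact (hmeas _ Metric.isOpen_ball).inter
      (measurableSet_le (hw.1.dist measurable_const) measurable_const)
  choose! nx hnx hnx' using step
  obtain ⟨w0, hw0⟩ := h0
  let v : ℕ → α → E := fun k => Nat.rec w0 (fun k w => nx k w) k
  have hv : ∀ k, Q k (v k) := fun k => by
    induction k with
    | zero => exact hw0
    | succ k ih => exact hnx k _ ih
  have hcau : ∀ t, CauchySeq fun k => v k t := fun t =>
    cauchySeq_of_le_geometric (1 / 2) 2 (by norm_num) fun k => hnx' k _ (hv k) t
  choose w hw using fun t => cauchySeq_tendsto_of_complete (hcau t)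
  refine ⟨w, measurable_of_tendsto_metrizable (fun k => (hv k).1) (tendsto_pi_nhds.2 hw),
    fun t => ?_⟩
  choose e he he' using fun k => (hv k).2 t
  have hpow : Tendsto (fun k : ℕ => ((1 : ℝ) / 2) ^ k) atTop (𝓝 0) :=
    tendsto_pow_atTop_nhds_zero_of_lt_one (by norm_num) (by norm_num)
  refine (hcl t).mem_of_tendsto (f := e) (b := atTop) ?_ (Eventually.of_forall he)
  refine (hw t).congr_dist (squeeze_zero (fun _ => dist_nonneg) (fun k => ?_) hpow)
  rw [dist_comm]; exact le_of_lt (he' k)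

/-- A Castaing representation: countably many measurable selections whose values are dense. -/
theorem exists_dense_measurable_selections {α E : Type*} [MeasurableSpace α] [MetricSpace E]
    [CompleteSpace E] [SecondCountableTopology E] [Nonempty E] [MeasurableSpace E] [BorelSpace E]
    {W : α → Set E} (hne : ∀ t, (W t).Nonempty) (hcl : ∀ t, IsClosed (W t))
    (hmeas : ∀ O, IsOpen O → MeasurableSet {t | (W t ∩ O).Nonempty}) :
    ∃ w : ℕ × ℕ → α → E, (∀ i, Measurable (w i)) ∧ (∀ i t, w i t ∈ W t) ∧
      ∀ t, W t ⊆ closure (range fun i => w i t) := by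
  classical
  let q := TopologicalSpace.denseSeq E
  have key : ∀ i : ℕ × ℕ, ∃ w : α → E, Measurable w ∧ (∀ t, w t ∈ W t) ∧
      ∀ t, (W t ∩ Metric.ball (q i.1) (1 / (i.2 + 1))).Nonempty →
        dist (w t) (q i.1) ≤ 1 / (i.2 + 1) := by
    intro i
    set B := Metric.ball (q i.1) (1 / ((i.2 : ℝ) + 1)) with hB
    let V : α → Set E := fun t => if (W t ∩ B).Nonempty then closure (W t ∩ B) else W t
    have hVW : ∀ t, V t ⊆ W t := fun t => by
      simp only [V]; split_ifs
      · exact closure_minimal inter_subset_left (hcl t)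
      · exact subset_rfl
    obtain ⟨w, hw, hwV⟩ := exists_measurable_selection (W := V)
      (fun t => by
        simp only [V]; split_ifs with h
        · exact h.closure
        · exact hne t)
      (fun t => by
        simp only [V]; split_ifs with h
        · exact isClosed_closure
        · exact hcl t)
      (fun O hO => by
        have : {t | (V t ∩ O).Nonempty} = {t | (W t ∩ (B ∩ O)).Nonempty} ∪
            ({t | (W t ∩ B).Nonempty}ᶜ ∩ {t | (W t ∩ O).Nonempty}) := by
          ext t
          by_cases h : (W t ∩ B).Nonempty
          · have h' : V t = closure (W t ∩ B) := if_pos h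
            simp only [mem_ofPred_eq, mem_union, mem_inter_iff, mem_compl_iff, h', h,
              not_true, false_and, or_false, ← inter_assoc]
            exact closure_inter_open_nonempty_iff hO
          · have h' : V t = W t := if_neg h
            have h2 : ¬ (W t ∩ (B ∩ O)).Nonempty := fun h2 =>
              h (h2.mono (inter_subset_inter_right _ inter_subset_left))
            simp only [mem_ofPred_eq, mem_union, mem_inter_iff, mem_compl_iff, h', h, h2,
              not_false_iff, true_and, false_or]
        rw [this]
        exact (hmeas _ (Metric.isOpen_ball.inter hO)).union
          ((hmeas _ Metric.isOpen_ball).compl.inter (hmeas _ hO)))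
    refine ⟨w, hw, fun t => hVW t (hwV t), fun t ht => ?_⟩
    have h1 : w t ∈ closure (W t ∩ B) := by
      have h' : V t = closure (W t ∩ B) := if_pos ht
      exact h' ▸ hwV t
    have h2 := closure_mono inter_subset_right h1
    exact Metric.closure_ball_subset_closedBall h2
  choose w hw hwW hwd using key
  refine ⟨w, hw, hwW, fun t e he => Metric.mem_closure_iff.2 fun ε hε => ?_⟩
  obtain ⟨k, hk⟩ := exists_nat_one_div_lt (half_pos hε)
  have hk' : (0 : ℝ) < 1 / ((k : ℝ) + 1) := Nat.one_div_pos_of_nat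
  obtain ⟨i, hi'⟩ := (TopologicalSpace.denseRange_denseSeq E).exists_dist_lt e hk'
  refine ⟨_, ⟨(i, k), rfl⟩, ?_⟩
  have h1 := hwd (i, k) t ⟨e, he, hi'⟩
  have h2 := dist_triangle_right e (w (i, k) t) (q i)
  simp only at h1
  linarith

/-- Filippov's implicit function lemma: a measurable function `z` with `z t ∈ H t '' W t` has the
form `t ↦ H t (w t)` with a measurable selection `w` of `W`. -/
theorem exists_measurable_selection_eq {α E F : Type*} [MeasurableSpace α] [MetricSpace E]
    [CompleteSpace E] [SecondCountableTopology E] [Nonempty E] [MeasurableSpace E] [BorelSpace E]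
    [MetricSpace F] [SecondCountableTopology F] [MeasurableSpace F] [BorelSpace F]
    {W : α → Set E} (hcpt : ∀ t, IsCompact (W t))
    (hmeas : ∀ O, IsOpen O → MeasurableSet {t | (W t ∩ O).Nonempty})
    {H : α → E → F} (hcont : ∀ t, ContinuousOn (H t) (W t))
    (hH : ∀ w, Measurable w → (∀ t, w t ∈ W t) → Measurable fun t => H t (w t))
    {z : α → F} (hz : Measurable z) (hzW : ∀ t, z t ∈ H t '' W t) :
    ∃ w : α → E, Measurable w ∧ ∀ t, w t ∈ W t ∧ H t (w t) = z t := by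
  have hcl : ∀ t, IsClosed (W t) := fun t => (hcpt t).isClosed
  have hne : ∀ t, (W t).Nonempty := fun t => by
    obtain ⟨e, he, -⟩ := hzW t; exact ⟨e, he⟩
  obtain ⟨w, hw, hwW, hdense⟩ := exists_dense_measurable_selections hne hcl hmeas
  let V : α → Set E := fun t => {e | e ∈ W t ∧ H t e = z t}
  have hVcl : ∀ t, IsClosed (V t) := fun t =>
    (hcont t).preimage_isClosed_of_isClosed (hcl t) (isClosed_singleton (x := z t))
  -- meeting a closed ball is a countable condition on the dense selections, by compactness
  have hball : ∀ (e : E) (r : ℝ), MeasurableSet {t | (V t ∩ Metric.closedBall e r).Nonempty} := by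
    intro e r
    have : {t | (V t ∩ Metric.closedBall e r).Nonempty} = ⋂ k : ℕ, ⋃ i,
        {t | dist (w i t) e < r + 1 / (k + 1) ∧ dist (H t (w i t)) (z t) < 1 / (k + 1)} := by
      ext t
      simp only [mem_ofPred_eq, mem_iInter, mem_iUnion]
      constructor
      · rintro ⟨e', ⟨he'W, he'z⟩, he'⟩ k
        have hk : (0 : ℝ) < 1 / ((k : ℝ) + 1) := Nat.one_div_pos_of_nat
        have hc := Metric.continuousOn_iff.1 (hcont t) e' he'W _ hk
        obtain ⟨δ, hδ, hc⟩ := hc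
        obtain ⟨_, ⟨i, rfl⟩, hi⟩ := Metric.mem_closure_iff.1 (hdense t he'W) (min δ (1 / (k + 1)))
          (lt_min hδ hk)
        rw [dist_comm] at hi
        refine ⟨i, ?_, ?_⟩
        · have h1 := dist_triangle (w i t) e' e
          have h2 : dist e' e ≤ r := he'
          have h3 := lt_of_lt_of_le hi (min_le_right _ _)
          linarith
        · rw [← he'z]
          exact hc _ (hwW i t) (lt_of_lt_of_le hi (min_le_left _ _))
      · intro h
        choose i hi1 hi2 using h
        obtain ⟨e', he'W, φ, hφ, hlim⟩ := (hcpt t).tendsto_subseq (x := fun k => w (i k) t)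
          fun k => hwW _ t
        have hsmall : Tendsto (fun k : ℕ => 1 / (((φ k : ℕ) : ℝ) + 1)) atTop (𝓝 0) :=
          tendsto_one_div_add_atTop_nhds_zero_nat.comp hφ.tendsto_atTop
        refine ⟨e', ⟨he'W, ?_⟩, ?_⟩
        · have h1 : Tendsto (fun k => H t (w (i (φ k)) t)) atTop (𝓝 (H t e')) :=
            (hcont t e' he'W).tendsto.comp (tendsto_nhdsWithin_iff.2
              ⟨hlim, Eventually.of_forall fun k => hwW _ t⟩)
          refine tendsto_nhds_unique h1 ?_
          rw [tendsto_iff_dist_tendsto_zero]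
          exact squeeze_zero (fun _ => dist_nonneg) (fun k => (hi2 (φ k)).le) hsmall
        · have h1 : Tendsto (fun k => dist (w (i (φ k)) t) e) atTop (𝓝 (dist e' e)) :=
            hlim.dist tendsto_const_nhds
          have h2 : Tendsto (fun k : ℕ => r + 1 / (((φ k : ℕ) : ℝ) + 1)) atTop (𝓝 r) := by
            simpa using hsmall.const_add r
          exact le_of_tendsto_of_tendsto' h1 h2 fun k => (hi1 (φ k)).le
    rw [this]
    refine MeasurableSet.iInter fun k => MeasurableSet.iUnion fun i => ?_
    exact (measurableSet_lt ((hw i).dist measurable_const) measurable_const).inter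
      (measurableSet_lt ((hH _ (hw i) (hwW i)).dist hz) measurable_const)
  obtain ⟨v, hv, hvV⟩ := exists_measurable_selection (W := V)
    (fun t => by obtain ⟨e, he, he'⟩ := hzW t; exact ⟨e, he, he'⟩) hVcl (fun O hO => by
      let q := TopologicalSpace.denseSeq E
      have : {t | (V t ∩ O).Nonempty} = ⋃ (i : ℕ × ℕ)
          (_ : Metric.closedBall (q i.1) (1 / ((i.2 : ℝ) + 1)) ⊆ O),
            {t | (V t ∩ Metric.closedBall (q i.1) (1 / ((i.2 : ℝ) + 1))).Nonempty} := by
        ext t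
        simp only [mem_ofPred_eq, mem_iUnion, exists_prop]
        constructor
        · rintro ⟨e, heV, heO⟩
          obtain ⟨ε, hε, hεO⟩ := Metric.isOpen_iff.1 hO e heO
          obtain ⟨k, hk⟩ := exists_nat_one_div_lt (half_pos hε)
          have hk' : (0 : ℝ) < 1 / ((k : ℝ) + 1) := Nat.one_div_pos_of_nat
          obtain ⟨i, hi⟩ := (TopologicalSpace.denseRange_denseSeq E).exists_dist_lt e hk'
          refine ⟨(i, k), fun e' he' => hεO ?_, e, heV, ?_⟩
          · have h1 : dist e' (q i) ≤ 1 / ((k : ℝ) + 1) := he'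
            have h2 := dist_triangle e' (q i) e
            rw [dist_comm (q i) e] at h2
            simp only [Metric.mem_ball]
            linarith
          · exact hi.le
        · rintro ⟨i, hiO, e, heV, hei⟩
          exact ⟨e, heV, hiO hei⟩
      rw [this]
      exact MeasurableSet.iUnion fun i => MeasurableSet.iUnion fun _ => hball _ _)
  exact ⟨v, hv, hvV⟩

/-! ### A theorem of the alternative -/

/-- Gordan's theorem: positively linearly independent vectors lie in an open half-space. -/
theorem exists_inner_neg_of_positively_independent {ι E : Type*} [Fintype ι]
    [NormedAddCommGroup E] [InnerProductSpace ℝ E] [CompleteSpace E] (a : ι → E)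
    (ha : ∀ c : ι → ℝ, (∀ i, 0 ≤ c i) → ∑ i, c i • a i = 0 → ∀ i, c i = 0) :
    ∃ v : E, ∀ i, inner ℝ (a i) v < 0 := by
  classical
  let A : (ι → ℝ) →ₗ[ℝ] E := Fintype.linearCombination ℝ a
  have hA : ∀ c, A c = ∑ i, c i • a i := fun c => Fintype.linearCombination_apply ℝ a c
  have h0 : (0 : E) ∉ A '' stdSimplex ℝ ι := by
    rintro ⟨c, hc, hc0⟩
    have := ha c hc.1 (by rw [← hA, hc0])
    have h1 := hc.2
    simp [this] at h1
  have hconv : Convex ℝ (A '' stdSimplex ℝ ι) := (convex_stdSimplex ℝ ι).linear_image A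
  have hcl : IsClosed (A '' stdSimplex ℝ ι) :=
    ((isCompact_stdSimplex ℝ ι).image A.continuous_of_finiteDimensional).isClosed
  obtain ⟨p, s, hp, hs⟩ := geometric_hahn_banach_closed_point hconv hcl h0
  refine ⟨(InnerProductSpace.toDual ℝ E).symm p, fun i => ?_⟩
  rw [real_inner_comm, InnerProductSpace.toDual_symm_apply]
  have := hp (a i) ⟨Pi.single i 1, single_mem_stdSimplex ℝ i, by
    rw [hA]; simp [Pi.single_apply]⟩
  simp only [map_zero] at hs
  linarith

/-! ### Geometry of the sweeping sets -/

namespace Problem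

variable {n l m r : ℕ} {P : Problem n l m r}

/-- `RegularGenerators` for a given radius `ρ` and a given Lipschitz constant `L`. -/
def RegularWith (P : Problem n l m r) (ρ L : ℝ) : Prop :=
  ∀ i,
    (∀ t x c, (t, c) ∈ P.graphC → ‖x - c‖ < ρ → DifferentiableAt ℝ (P.ψ i t) x) ∧
    (∀ t₁ x₁ c₁ t₂ x₂ c₂, (t₁, c₁) ∈ P.graphC → ‖x₁ - c₁‖ ≤ ρ / 2 →
      (t₂, c₂) ∈ P.graphC → ‖x₂ - c₂‖ ≤ ρ / 2 →
      max |P.ψ i t₁ x₁ - P.ψ i t₂ x₂| ‖gradient (P.ψ i t₁) x₁ - gradient (P.ψ i t₂) x₂‖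
        ≤ L * (|t₁ - t₂| + ‖x₁ - x₂‖))

/-- `v` is an inward direction of `C(t)` at `x` with modulus `η`: a vector of norm at most `1` along
which every active generator decreases at rate at least `η`. -/
def IsInward (P : Problem n l m r) (η t : ℝ) (x v : Vec n) : Prop :=
  ‖v‖ ≤ 1 ∧ ∀ i, P.ψ i t x = 0 → inner ℝ (gradient (P.ψ i t) x) v ≤ -η

theorem isClosed_graphC
    (hψ : ∀ i, ContinuousOn (fun q : ℝ × Vec n => P.ψ i q.1 q.2) (Icc 0 P.T ×ˢ univ)) :
    IsClosed P.graphC := by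
  have hbase : IsClosed (Icc 0 P.T ×ˢ (univ : Set (Vec n))) := isClosed_Icc.prod isClosed_univ
  have : P.graphC = (Icc 0 P.T ×ˢ (univ : Set (Vec n))) ∩
      ⋂ i, (Icc 0 P.T ×ˢ univ) ∩ (fun q : ℝ × Vec n => P.ψ i q.1 q.2) ⁻¹' Iic 0 := by
    ext q
    simp only [graphC, C, mem_ofPred_eq, mem_inter_iff, mem_prod, mem_univ, and_true, mem_iInter,
      mem_preimage, mem_Iic]
    exact ⟨fun h => ⟨h.1, fun i => ⟨h.1, h.2 i⟩⟩, fun h => ⟨h.1, fun i => (h.2 i).2⟩⟩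
  rw [this]
  exact hbase.inter (isClosed_iInter fun i =>
    (hψ i).preimage_isClosed_of_isClosed hbase isClosed_Iic)

theorem isCompact_graphC
    (hψ : ∀ i, ContinuousOn (fun q : ℝ × Vec n => P.ψ i q.1 q.2) (Icc 0 P.T ×ˢ univ))
    (hC : Bornology.IsBounded P.graphC) : IsCompact P.graphC :=
  Metric.isCompact_of_isClosed_isBounded (isClosed_graphC hψ) hC

theorem continuous_ψ
    (hψ : ∀ i, ContinuousOn (fun q : ℝ × Vec n => P.ψ i q.1 q.2) (Icc 0 P.T ×ˢ univ))
    {t : ℝ} (ht : t ∈ Icc 0 P.T) (i : Fin r) : Continuous (P.ψ i t) := by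
  have : ContinuousOn (fun x : Vec n => P.ψ i t x) univ :=
    (hψ i).comp (f := fun x : Vec n => (t, x)) (by fun_prop) fun x _ => ⟨ht, mem_univ _⟩
  exact continuousOn_univ.1 this

theorem isClosed_C
    (hψ : ∀ i, ContinuousOn (fun q : ℝ × Vec n => P.ψ i q.1 q.2) (Icc 0 P.T ×ˢ univ))
    {t : ℝ} (ht : t ∈ Icc 0 P.T) : IsClosed (P.C t) := by
  have : P.C t = ⋂ i, {x | P.ψ i t x ≤ 0} := by ext; simp [C]
  rw [this]
  exact isClosed_iInter fun i => isClosed_le (continuous_ψ hψ ht i) continuous_const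

namespace RegularWith

variable {ρ L : ℝ}

theorem hasFDerivAt (h : P.RegularWith ρ L) {t : ℝ} {x c : Vec n} (hc : (t, c) ∈ P.graphC)
    (hx : ‖x - c‖ < ρ) (i : Fin r) :
    HasFDerivAt (P.ψ i t) (InnerProductSpace.toDual ℝ (Vec n) (gradient (P.ψ i t) x)) x :=
  ((h i).1 t x c hc hx).hasGradientAt

theorem norm_gradient_sub_le (h : P.RegularWith ρ L) (hρ : 0 < ρ) {t : ℝ} {x y : Vec n}
    (hx : (t, x) ∈ P.graphC) (hy : ‖y - x‖ ≤ ρ / 2) (i : Fin r) :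
    ‖gradient (P.ψ i t) y - gradient (P.ψ i t) x‖ ≤ L * ‖y - x‖ := by
  have := (h i).2 t y x t x x hx hy hx (by simp; positivity)
  simpa using (le_max_right _ _).trans this

theorem hasStrictFDerivAt (h : P.RegularWith ρ L) (hρ : 0 < ρ) {t : ℝ} {x : Vec n}
    (hx : (t, x) ∈ P.graphC) (i : Fin r) :
    HasStrictFDerivAt (P.ψ i t)
      (InnerProductSpace.toDual ℝ (Vec n) (gradient (P.ψ i t) x)) x := by
  refine hasStrictFDerivAt_of_hasFDerivAt_of_continuousAt
    (f' := fun y => InnerProductSpace.toDual ℝ (Vec n) (gradient (P.ψ i t) y)) ?_ ?_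
  · filter_upwards [Metric.ball_mem_nhds x hρ] with y hy
    exact h.hasFDerivAt hx (by simpa [dist_eq_norm] using hy) i
  · refine (InnerProductSpace.toDual ℝ (Vec n)).continuous.continuousAt.comp ?_
    rw [ContinuousAt, tendsto_iff_norm_sub_tendsto_zero]
    have hlim : Tendsto (fun y : Vec n => L * ‖y - x‖) (𝓝 x) (𝓝 0) := by
      have : Continuous fun y : Vec n => L * ‖y - x‖ := by fun_prop
      simpa using this.tendsto x
    refine squeeze_zero' (Eventually.of_forall fun _ => norm_nonneg _) ?_ hlim
    filter_upwards [Metric.closedBall_mem_nhds x (half_pos hρ)] with y hy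
    exact h.norm_gradient_sub_le hρ hx (by simpa [dist_eq_norm] using hy) i

theorem inner_gradient_sub_le (h : P.RegularWith ρ L) (hρ : 0 < ρ) {t : ℝ} {x c : Vec n}
    (hx : (t, x) ∈ P.graphC) (hc : ‖c - x‖ ≤ ρ / 2) (i : Fin r) :
    inner ℝ (gradient (P.ψ i t) x) (c - x) ≤ P.ψ i t c - P.ψ i t x + L * ‖c - x‖ ^ 2 := by
  have hL : ∀ y ∈ Metric.closedBall x ‖c - x‖, ‖y - x‖ ≤ ‖c - x‖ := fun y hy => by
    simpa [dist_eq_norm] using hy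
  have hgrad : ∀ y ∈ Metric.closedBall x ‖c - x‖,
      ‖InnerProductSpace.toDual ℝ (Vec n) (gradient (P.ψ i t) y) -
        InnerProductSpace.toDual ℝ (Vec n) (gradient (P.ψ i t) x)‖ ≤ |L| * ‖c - x‖ := by
    intro y hy
    rw [← map_sub, LinearIsometryEquiv.norm_map]
    refine (h.norm_gradient_sub_le hρ hx ((hL y hy).trans hc) i).trans ?_
    exact mul_le_mul (le_abs_self L) (hL y hy) (norm_nonneg _) (abs_nonneg _)
  by_cases hcx : c = x
  · simp [hcx]
  have hL0 : 0 ≤ L := by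
    have h1 := (norm_nonneg _).trans (h.norm_gradient_sub_le hρ hx hc i)
    exact nonneg_of_mul_nonneg_left h1 (norm_pos_iff.2 (sub_ne_zero.2 hcx))
  have key := Convex.norm_image_sub_le_of_norm_hasFDerivWithin_le'
    (fun y hy => (h.hasFDerivAt hx (by have := hL y hy; linarith) i).hasFDerivWithinAt) hgrad
    (convex_closedBall x _) (x := x) (y := c) (by simp) (by simp [dist_eq_norm])
  rw [InnerProductSpace.toDual_apply_apply, Real.norm_eq_abs, abs_of_nonneg hL0] at key
  have := (abs_le.1 key).1
  nlinarith

end RegularWith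

/-- The constraint qualification holds with a uniform modulus, because the graph is compact. -/
theorem exists_isInward {ρ L : ℝ} (h : P.RegularWith ρ L) (hρ : 0 < ρ)
    (hψ : ∀ i, ContinuousOn (fun q : ℝ × Vec n => P.ψ i q.1 q.2) (Icc 0 P.T ×ˢ univ))
    (hC : Bornology.IsBounded P.graphC) (hcq : P.ConstraintQualification) :
    ∃ η > 0, ∀ q ∈ P.graphC, ∃ v, P.IsInward η q.1 q.2 v := by
  classical
  have hloc : ∀ q ∈ P.graphC, ∃ η > 0, ∀ᶠ q' in 𝓝[P.graphC] q, ∃ v, P.IsInward η q'.1 q'.2 v := by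
    rintro ⟨t, x⟩ hq
    obtain ⟨v, hv⟩ := exists_inner_neg_of_positively_independent
      (fun i : {i // P.ψ i t x = 0} => gradient (P.ψ i t) x) (fun c hc0 hc i => by
        have h1 := hcq t x hq (fun i => if hi : P.ψ i t x = 0 then c ⟨i, hi⟩ else 0)
          (fun i hi => by simpa [hi] using hc0 ⟨i, hi⟩) (by
            rw [← hc, ← Finset.sum_subtype_of_mem (p := fun i => P.ψ i t x = 0)
              (fun i => (if hi : P.ψ i t x = 0 then c ⟨i, hi⟩ else 0) • gradient (P.ψ i t) x)
              (fun i hi => (Finset.mem_filter.1 hi).2)]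
            refine Finset.sum_congr (by ext i; simp [i.2]) fun i _ => by simp [i.2])
          i i.2
        simpa [i.2] using h1)
    obtain ⟨δ, hδ, hvδ⟩ : ∃ δ > 0, ∀ i, P.ψ i t x = 0 → inner ℝ (gradient (P.ψ i t) x) v ≤ -δ := by
      have hev : ∀ᶠ δ in 𝓝[>] (0 : ℝ), ∀ i, P.ψ i t x = 0 →
          inner ℝ (gradient (P.ψ i t) x) v ≤ -δ := by
        refine eventually_all.2 fun i => ?_
        by_cases hi : P.ψ i t x = 0
        · have h1 : (0 : ℝ) < -inner ℝ (gradient (P.ψ i t) x) v := by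
            have := hv ⟨i, hi⟩; simp only at this; linarith
          filter_upwards [mem_nhdsWithin_of_mem_nhds (Iic_mem_nhds h1)] with δ hδ _
          have : δ ≤ -inner ℝ (gradient (P.ψ i t) x) v := hδ
          linarith
        · exact Eventually.of_forall fun δ hi' => absurd hi' hi
      obtain ⟨δ, hδ, hδ'⟩ := (hev.and self_mem_nhdsWithin).exists
      exact ⟨δ, hδ', hδ⟩
    have hv1 : 0 < ‖v‖ + 1 := by positivity
    refine ⟨δ / 2 / (‖v‖ + 1), by positivity, ?_⟩
    have hev : ∀ i, ∀ᶠ q' in 𝓝[P.graphC] (t, x), P.ψ i q'.1 q'.2 = 0 →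
        inner ℝ (gradient (P.ψ i q'.1) q'.2) v ≤ -(δ / 2) := by
      intro i
      by_cases hi : P.ψ i t x = 0
      · have hlim : Tendsto (fun q' : ℝ × Vec n => L * (|q'.1 - t| + ‖q'.2 - x‖) * ‖v‖)
            (𝓝[P.graphC] (t, x)) (𝓝 0) := by
          have : Continuous fun q' : ℝ × Vec n => L * (|q'.1 - t| + ‖q'.2 - x‖) * ‖v‖ := by
            fun_prop
          simpa using (this.tendsto (t, x)).mono_left nhdsWithin_le_nhds
        filter_upwards [hlim.eventually_lt_const (half_pos hδ), self_mem_nhdsWithin]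
          with q' hq' hq'C _
        have h1 := (le_max_right _ _).trans ((h i).2 q'.1 q'.2 q'.2 t x x hq'C
          (by simp; positivity) hq (by simp; positivity))
        have h2 : inner ℝ (gradient (P.ψ i q'.1) q'.2) v - inner ℝ (gradient (P.ψ i t) x) v ≤
            L * (|q'.1 - t| + ‖q'.2 - x‖) * ‖v‖ := by
          rw [← inner_sub_left]
          exact (real_inner_le_norm _ _).trans (mul_le_mul_of_nonneg_right h1 (norm_nonneg _))
        have h3 := hvδ i hi
        linarith
      · have hc : Tendsto (fun q' : ℝ × Vec n => P.ψ i q'.1 q'.2) (𝓝[P.graphC] (t, x))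
            (𝓝 (P.ψ i t x)) :=
          (hψ i (t, x) ⟨hq.1, mem_univ _⟩).mono_left
            (nhdsWithin_mono _ fun q' hq' => ⟨hq'.1, mem_univ _⟩)
        filter_upwards [hc.eventually_ne hi] with q' hq' h0
        exact absurd h0 hq'
    filter_upwards [eventually_all.2 hev] with q' hq'
    refine ⟨(‖v‖ + 1)⁻¹ • v, ?_, fun i hi => ?_⟩
    · rw [norm_smul, norm_inv, Real.norm_of_nonneg hv1.le, inv_mul_le_iff₀ hv1]
      linarith
    · rw [inner_smul_right, inv_mul_le_iff₀ hv1]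
      have := hq' i hi
      have h2 : (‖v‖ + 1) * -(δ / 2 / (‖v‖ + 1)) = -(δ / 2) := by field_simp
      linarith
  choose! η hη hloc using hloc
  obtain ⟨s, hs, hcov⟩ := (isCompact_graphC hψ hC).elim_nhdsWithin_subcover _ hloc
  obtain ⟨η₀, hη₀, hη₀s⟩ : ∃ η₀ > 0, ∀ q ∈ s, η₀ ≤ η q := by
    have hev : ∀ᶠ δ in 𝓝[>] (0 : ℝ), ∀ q ∈ s, δ ≤ η q :=
      (Finset.eventually_all s).2 fun q hq =>
        mem_nhdsWithin_of_mem_nhds (Iic_mem_nhds (hη q (hs q hq)))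
    obtain ⟨δ, hδ, hδ'⟩ := (hev.and self_mem_nhdsWithin).exists
    exact ⟨δ, hδ', hδ⟩
  refine ⟨η₀, hη₀, fun q hq => ?_⟩
  obtain ⟨q', hq', hqq'⟩ := mem_iUnion₂.1 (hcov hq)
  obtain ⟨v, hv1, hv⟩ := hqq'
  exact ⟨v, hv1, fun i hi => (hv i hi).trans (neg_le_neg (hη₀s q' hq'))⟩

/-- Directions along which all active generators strictly decrease are Clarke tangent. -/
theorem mem_clarkeTangentCone_of_inner_neg {ρ L : ℝ} (h : P.RegularWith ρ L) (hρ : 0 < ρ)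
    (hψ : ∀ i, ContinuousOn (fun q : ℝ × Vec n => P.ψ i q.1 q.2) (Icc 0 P.T ×ˢ univ))
    {t : ℝ} {x v : Vec n} (hx : (t, x) ∈ P.graphC)
    (hv : ∀ i, P.ψ i t x = 0 → inner ℝ (gradient (P.ψ i t) x) v < 0) :
    v ∈ clarkeTangentCone (P.C t) x := by
  classical
  intro a τ ha hax hτ hτ0
  have hstep : Tendsto (fun j => a j + τ j • v) atTop (𝓝 x) := by
    simpa using hax.add (hτ0.smul_const v)
  have hev : ∀ᶠ j in atTop, a j + τ j • v ∈ P.C t := by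
    refine eventually_all.2 fun i => ?_
    by_cases hi : P.ψ i t x = 0
    · set p := inner ℝ (gradient (P.ψ i t) x) v with hp
      have hp0 : p < 0 := hv i hi
      have hv0 : 0 < ‖v‖ := norm_pos_iff.2 fun hv0 => by simp [hp, hv0] at hp0
      have hst := (h.hasStrictFDerivAt hρ hx i).isLittleO.comp_tendsto
        (hstep.prodMk_nhds hax)
      have hbd := hst.bound (c := -p / ‖v‖) (div_pos (neg_pos.2 hp0) hv0)
      filter_upwards [hbd] with j hj
      simp only [Function.comp_apply, add_sub_cancel_left, InnerProductSpace.toDual_apply_apply,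
        norm_smul, Real.norm_of_nonneg (hτ j).le] at hj
      have h1 : -p / ‖v‖ * (τ j * ‖v‖) = -p * τ j := by field_simp
      rw [h1, Real.norm_eq_abs, inner_smul_right, ← hp] at hj
      have h2 := (abs_le.1 hj).2
      have h3 := ha j i
      linarith
    · have hlt : P.ψ i t x < 0 := lt_of_le_of_ne (hx.2 i) hi
      filter_upwards [(((continuous_ψ hψ hx.1 i).tendsto x).comp hstep).eventually_lt_const hlt]
        with j hj using hj.le
  refine ⟨fun j => if a j + τ j • v ∈ P.C t then v else 0, ?_, fun j => ?_⟩
  · refine tendsto_const_nhds.congr' ?_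
    filter_upwards [hev] with j hj
    rw [if_pos hj]
  · by_cases hj : a j + τ j • v ∈ P.C t
    · simpa only [if_pos hj] using hj
    · simpa [if_neg hj] using ha j

/-- A quantitative form of the polarity between normal vectors and linearized tangent vectors. -/
theorem inner_le_of_mem_clarkeNormalCone {ρ L η b : ℝ} (h : P.RegularWith ρ L) (hρ : 0 < ρ)
    (hψ : ∀ i, ContinuousOn (fun q : ℝ × Vec n => P.ψ i q.1 q.2) (Icc 0 P.T ×ˢ univ))
    (hη : 0 < η) (hb : 0 ≤ b) {t : ℝ} {x v w ν : Vec n} (ht : t ∈ Icc 0 P.T)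
    (hv : P.IsInward η t x v) (hν : ν ∈ clarkeNormalCone (P.C t) x)
    (hw : ∀ i, P.ψ i t x = 0 → inner ℝ (gradient (P.ψ i t) x) w ≤ b) :
    inner ℝ ν w ≤ b / η * ‖ν‖ := by
  have key : ∀ δ > 0, inner ℝ ν w ≤ (b + δ) / η * ‖ν‖ := by
    intro δ hδ
    have hpos : 0 < (b + δ) / η := by positivity
    have htan := hν.2 (w + ((b + δ) / η) • v)
      (mem_clarkeTangentCone_of_inner_neg h hρ hψ ⟨ht, hν.1⟩ fun i hi => by
        rw [inner_add_right, inner_smul_right]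
        have h1 := mul_le_mul_of_nonneg_left (hv.2 i hi) hpos.le
        have h2 : (b + δ) / η * -η = -(b + δ) := by field_simp
        have h3 := hw i hi
        linarith)
    rw [inner_add_right, inner_smul_right] at htan
    have h1 : -(‖ν‖ * ‖v‖) ≤ inner ℝ ν v := (abs_le.1 (abs_real_inner_le_norm ν v)).1
    have h2 : ‖ν‖ * ‖v‖ ≤ ‖ν‖ := mul_le_of_le_one_right (norm_nonneg _) hv.1
    have h3 : (b + δ) / η * -‖ν‖ ≤ (b + δ) / η * inner ℝ ν v :=
      mul_le_mul_of_nonneg_left (by linarith) hpos.le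
    linarith
  have hlim : Tendsto (fun δ : ℝ => (b + δ) / η * ‖ν‖) (𝓝[>] 0) (𝓝 (b / η * ‖ν‖)) := by
    have : Continuous fun δ : ℝ => (b + δ) / η * ‖ν‖ := by fun_prop
    simpa using (this.tendsto 0).mono_left nhdsWithin_le_nhds
  exact ge_of_tendsto hlim (by filter_upwards [self_mem_nhdsWithin] with δ hδ using key δ hδ)

/-- Hypomonotonicity: normal vectors satisfy a quadratic one-sided estimate with a uniform
constant (uniform prox-regularity of `C(t)`). -/
theorem inner_sub_le_of_mem_clarkeNormalCone {ρ L η : ℝ} (h : P.RegularWith ρ L) (hρ : 0 < ρ)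
    (hL : 0 ≤ L)
    (hψ : ∀ i, ContinuousOn (fun q : ℝ × Vec n => P.ψ i q.1 q.2) (Icc 0 P.T ×ˢ univ))
    (hη : 0 < η) {t : ℝ} {x c v ν : Vec n} (ht : t ∈ Icc 0 P.T)
    (hv : P.IsInward η t x v) (hν : ν ∈ clarkeNormalCone (P.C t) x)
    (hc : c ∈ P.C t) (hcx : ‖c - x‖ ≤ ρ / 2) :
    inner ℝ ν (c - x) ≤ L * ‖c - x‖ ^ 2 / η * ‖ν‖ := by
  refine inner_le_of_mem_clarkeNormalCone h hρ hψ hη (by positivity) ht hv hν fun i hi => ?_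
  have h1 := h.inner_gradient_sub_le hρ ⟨ht, hν.1⟩ hcx i
  have h2 := hc i
  linarith

/-- The normal part `ν` of the velocity `φ - ν` of a curve in the moving set is bounded: at earlier
times the curve lies in `C(·)`, whose generators have Lipschitz constant `L` in time, so that no
active generator, frozen at time `t`, decreases along the curve at a rate greater than `L`. -/
theorem norm_le_of_hasDerivAt {ρ L η M : ℝ} (h : P.RegularWith ρ L) (hρ : 0 < ρ) (hL : 0 ≤ L)
    (hψ : ∀ i, ContinuousOn (fun q : ℝ × Vec n => P.ψ i q.1 q.2) (Icc 0 P.T ×ˢ univ))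
    (hη : 0 < η) {t : ℝ} (ht0 : 0 < t) (htT : t ≤ P.T) {x : ℝ → Vec n} {v φ ν : Vec n}
    (hxC : ∀ s ∈ Icc 0 P.T, x s ∈ P.C s) (hx : HasDerivAt x (φ - ν) t)
    (hv : P.IsInward η t (x t) v) (hν : ν ∈ clarkeNormalCone (P.C t) (x t)) (hφ : ‖φ‖ ≤ M) :
    ‖ν‖ ≤ M + L / η := by
  have ht : t ∈ Icc 0 P.T := ⟨ht0.le, htT⟩
  have hxt : (t, x t) ∈ P.graphC := ⟨ht, hxC t ht⟩
  have hact : ∀ i, P.ψ i t (x t) = 0 → inner ℝ (gradient (P.ψ i t) (x t)) (ν - φ) ≤ L := by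
    intro i hi
    have hd : HasDerivAt (fun s => P.ψ i t (x s))
        (inner ℝ (gradient (P.ψ i t) (x t)) (φ - ν)) t := by
      have := (h.hasFDerivAt hxt (by simpa using hρ) i).comp_hasDerivAt t hx
      simpa using! this
    have hslope := (hasDerivAt_iff_tendsto_slope_left_right.1 hd).1
    have hge : ∀ᶠ s in 𝓝[<] t, -L ≤ slope (fun s => P.ψ i t (x s)) t s := by
      have hcl : Tendsto x (𝓝[<] t) (𝓝 (x t)) := hx.continuousAt.tendsto.mono_left nhdsWithin_le_nhds
      have hball := hcl.eventually (Metric.closedBall_mem_nhds (x t) (half_pos hρ))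
      filter_upwards [hball, Ioo_mem_nhdsLT ht0] with s hs hst
      have hsT : s ∈ Icc 0 P.T := ⟨hst.1.le, hst.2.le.trans htT⟩
      have hs' : ‖x s - x t‖ ≤ ρ / 2 := by simpa [dist_eq_norm] using hs
      have h1 := (le_max_left _ _).trans ((h i).2 t (x s) (x t) s (x s) (x s) hxt hs'
        ⟨hsT, hxC s hsT⟩ (by simp; positivity))
      rw [sub_self, norm_zero, add_zero, abs_of_pos (sub_pos.2 hst.2)] at h1
      have h2 := (abs_le.1 h1).2
      have h3 := hxC s hsT i
      rw [slope_def_field, hi, sub_zero, le_div_iff_of_neg (by linarith [hst.2])]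
      linarith
    have := ge_of_tendsto hslope hge
    rw [← neg_sub φ ν, inner_neg_right]
    linarith
  have key := inner_le_of_mem_clarkeNormalCone h hρ hψ hη hL ht hv hν hact
  rw [inner_sub_right, real_inner_self_eq_norm_sq] at key
  have h1 : inner ℝ ν φ ≤ ‖ν‖ * M :=
    (real_inner_le_norm ν φ).trans (mul_le_mul_of_nonneg_left hφ (norm_nonneg _))
  rcases (norm_nonneg ν).eq_or_lt with h0 | h0
  · rw [← h0]
    have := (norm_nonneg φ).trans hφ
    positivity
  · refine le_of_mul_le_mul_left ?_ h0
    nlinarith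

/-- `C(t)` is the closure of the set where all generators are negative. -/
theorem mem_closure_strict {ρ L η : ℝ} (h : P.RegularWith ρ L) (hρ : 0 < ρ)
    (hψ : ∀ i, ContinuousOn (fun q : ℝ × Vec n => P.ψ i q.1 q.2) (Icc 0 P.T ×ˢ univ))
    (hη : 0 < η) {t : ℝ} {c v : Vec n} (hc : (t, c) ∈ P.graphC) (hv : P.IsInward η t c v) :
    c ∈ closure {c' | ∀ i, P.ψ i t c' < 0} := by
  have hlim : Tendsto (fun ε : ℝ => c + ε • v) (𝓝[>] 0) (𝓝 c) := by
    have : Continuous fun ε : ℝ => c + ε • v := by fun_prop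
    simpa using (this.tendsto 0).mono_left nhdsWithin_le_nhds
  refine mem_closure_of_tendsto hlim ?_
  refine eventually_all.2 fun i => ?_
  by_cases hi : P.ψ i t c = 0
  · have hd : HasDerivAt (fun ε : ℝ => P.ψ i t (c + ε • v))
        (inner ℝ (gradient (P.ψ i t) c) v) 0 := by
      have hline : HasDerivAt (fun ε : ℝ => c + ε • v) v 0 := by
        simpa using ((hasDerivAt_id (0 : ℝ)).smul_const v).const_add c
      have hf : HasFDerivAt (P.ψ i t)
          (InnerProductSpace.toDual ℝ (Vec n) (gradient (P.ψ i t) c)) (c + (0 : ℝ) • v) := by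
        simpa using h.hasFDerivAt hc (by simpa using hρ) i
      have := hf.comp_hasDerivAt 0 hline
      simpa using! this
    have hslope := (hasDerivAt_iff_tendsto_slope_left_right.1 hd).2
    have hneg : inner ℝ (gradient (P.ψ i t) c) v < 0 := by linarith [hv.2 i hi]
    filter_upwards [hslope.eventually_lt_const hneg, self_mem_nhdsWithin] with ε hε hε0
    have hε0 : 0 < ε := hε0
    simp only [slope_def_field, zero_smul, add_zero, hi, sub_zero] at hε
    exact (div_neg_iff.1 hε).elim (fun h => absurd h.2 (not_lt.2 hε0.le)) fun h => h.1
  · have hlt : P.ψ i t c < 0 := lt_of_le_of_ne (hc.2 i) hi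
    exact (((continuous_ψ hψ hc.1 i).tendsto c).comp hlim).eventually_lt_const hlt

/-- A vector satisfying a quadratic one-sided estimate at all nearby points where every generator
is negative is normal. -/
theorem mem_clarkeNormalCone_of_inner_sub_le {ρ L η κ δ : ℝ} (h : P.RegularWith ρ L) (hρ : 0 < ρ)
    (hψ : ∀ i, ContinuousOn (fun q : ℝ × Vec n => P.ψ i q.1 q.2) (Icc 0 P.T ×ˢ univ))
    (hη : 0 < η) (hin : ∀ q ∈ P.graphC, ∃ v, P.IsInward η q.1 q.2 v)
    (hδ : 0 < δ) {t : ℝ} {x ν : Vec n} (hx : (t, x) ∈ P.graphC)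
    (hν : ∀ c, (∀ i, P.ψ i t c < 0) → ‖c - x‖ < δ → inner ℝ ν (c - x) ≤ κ * ‖c - x‖ ^ 2) :
    ν ∈ clarkeNormalCone (P.C t) x := by
  have hν' : ∀ c ∈ P.C t, ‖c - x‖ < δ → inner ℝ ν (c - x) ≤ κ * ‖c - x‖ ^ 2 := by
    intro c hc hcx
    have hct : (t, c) ∈ P.graphC := ⟨hx.1, hc⟩
    obtain ⟨v, hv⟩ := hin (t, c) hct
    obtain ⟨s, hs, hsc⟩ := mem_closure_iff_seq_limit.1 (mem_closure_strict h hρ hψ hη hct hv)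
    have h1 : Tendsto (fun j => inner ℝ ν (s j - x)) atTop (𝓝 (inner ℝ ν (c - x))) :=
      tendsto_const_nhds.inner (hsc.sub_const x)
    have h2 : Tendsto (fun j => ‖s j - x‖) atTop (𝓝 ‖c - x‖) := (hsc.sub_const x).norm
    refine le_of_tendsto_of_tendsto h1 ((h2.pow 2).const_mul κ) ?_
    filter_upwards [h2.eventually_lt_const hcx] with j hj using hν _ (hs j) hj
  refine ⟨hx.2, fun v hv => ?_⟩
  have hτ : Tendsto (fun j : ℕ => 1 / ((j : ℝ) + 1)) atTop (𝓝 0) :=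
    tendsto_one_div_add_atTop_nhds_zero_nat
  have hτ0 : ∀ j : ℕ, (0 : ℝ) < 1 / ((j : ℝ) + 1) := fun j => Nat.one_div_pos_of_nat
  obtain ⟨w, hwv, hw⟩ := hv (fun _ => x) _ (fun _ => hx.2) tendsto_const_nhds hτ0 hτ
  have hsmall : Tendsto (fun j : ℕ => ‖x + (1 / ((j : ℝ) + 1)) • w j - x‖) atTop (𝓝 0) := by
    simpa using (hτ.smul hwv).norm
  have hlim : Tendsto (fun j : ℕ => κ * (1 / ((j : ℝ) + 1) * ‖w j‖ ^ 2)) atTop (𝓝 0) := by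
    simpa using (hτ.mul (hwv.norm.pow 2)).const_mul κ
  refine le_of_tendsto_of_tendsto (tendsto_const_nhds.inner hwv) hlim ?_
  filter_upwards [hsmall.eventually_lt_const hδ] with j hj
  have h1 := hν' _ (hw j) hj
  rw [add_sub_cancel_left, inner_smul_right, norm_smul, Real.norm_of_nonneg (hτ0 j).le] at h1
  refine le_of_mul_le_mul_left ?_ (hτ0 j)
  calc _ ≤ _ := h1
    _ = _ := by ring

/-! ### Measurability and selection along trajectories -/

/-- Superposition: `t ↦ h (t, x t, y t, u t)` is measurable for continuous `(x, y)` with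
`x t ∈ C(t)`. As `h` is controlled only on `C(t)`, the curve is approximated by points of a
countable dense set that lie in `C(t)`; there are enough of them because `C(t)` is the closure of
an open set. -/
theorem aemeasurable_h_comp
    (hψ : ∀ i, ContinuousOn (fun q : ℝ × Vec n => P.ψ i q.1 q.2) (Icc 0 P.T ×ˢ univ))
    (hint : ∀ q ∈ P.graphC, q.2 ∈ closure {c | ∀ i, P.ψ i q.1 c < 0})
    (hmeas : ∀ x y, ∀ u ∈ P.controls, AEMeasurable (fun t => P.h t x y (u t))
      (volume.restrict {t | (t, x) ∈ P.graphC}))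
    (hcont : ∀ᵐ t ∂P.timeMeasure, ContinuousOn
      (fun q : Vec n × Vec l × Vec m => P.h t q.1 q.2.1 q.2.2) (P.C t ×ˢ univ ×ˢ P.U t))
    {x : ℝ → Vec n} {y : ℝ → Vec l} {u : ℝ → Vec m}
    (hx : ContinuousOn x (Icc 0 P.T)) (hy : ContinuousOn y (Icc 0 P.T))
    (hxC : ∀ t ∈ Icc 0 P.T, x t ∈ P.C t) (hu : u ∈ P.controls) :
    AEMeasurable (fun t => P.h t (x t) (y t) (u t)) P.timeMeasure := by
  classical
  let q := TopologicalSpace.denseSeq (Vec n × Vec l)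
  have hq : DenseRange q := TopologicalSpace.denseRange_denseSeq _
  have hw : ContinuousOn (fun t => (x t, y t)) (Icc 0 P.T) := hx.prodMk hy
  let A : ℕ → ℕ → Set ℝ := fun k i =>
    {t | (t, (q i).1) ∈ P.graphC} ∩
      ((fun t => (x t, y t)) ⁻¹' Metric.ball (q i) (1 / ((k : ℝ) + 1)) ∩ Icc 0 P.T)
  have hclosed : ∀ c, MeasurableSet {t | (t, c) ∈ P.graphC} := fun c =>
    ((isClosed_graphC hψ).preimage (f := fun t : ℝ => (t, c)) (by fun_prop)).measurableSet
  have hA : ∀ k i, MeasurableSet (A k i) := fun k i => by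
    obtain ⟨O, hO, hOe⟩ := continuousOn_iff'.1 hw _ (Metric.isOpen_ball (x := q i)
      (ε := 1 / ((k : ℝ) + 1)))
    refine (hclosed _).inter ?_
    rw [hOe]
    exact hO.measurableSet.inter measurableSet_Icc
  have hcover : ∀ k, ∀ t ∈ Icc 0 P.T, ∃ i, t ∈ A k i := by
    intro k t ht
    have hk : (0 : ℝ) < 1 / ((k : ℝ) + 1) := Nat.one_div_pos_of_nat
    obtain ⟨c, hc, hcx⟩ := Metric.mem_closure_iff.1 (hint (t, x t) ⟨ht, hxC t ht⟩) _ hk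
    have hopen : IsOpen ({c | ∀ i, P.ψ i t c < 0} ∩ Metric.ball (x t) (1 / ((k : ℝ) + 1))) := by
      refine IsOpen.inter ?_ Metric.isOpen_ball
      have : {c | ∀ i, P.ψ i t c < 0} = ⋂ i, {c | P.ψ i t c < 0} := by ext; simp
      rw [this]
      exact isOpen_iInter_of_finite fun i => isOpen_lt (continuous_ψ hψ ht i) continuous_const
    obtain ⟨i, ⟨hi1, hi2⟩, hi3⟩ := hq.exists_mem_open
      (hopen.prod (Metric.isOpen_ball (x := y t) (ε := 1 / ((k : ℝ) + 1))))
      ⟨(c, y t), ⟨hc, by rwa [Metric.mem_ball, dist_comm]⟩, by simpa using hk⟩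
    refine ⟨i, ⟨ht, fun j => (hi1 j).le⟩, ?_, ht⟩
    rw [mem_preimage, Metric.mem_ball, dist_comm, Prod.dist_eq]
    exact max_lt hi2 hi3
  -- the `k`-th approximation of the curve is `q (idx k t)`
  let idx : ℕ → ℝ → ℕ := fun k t => sInf {i | t ∈ A k i}
  have hidx : ∀ k, ∀ t ∈ Icc 0 P.T, t ∈ A k (idx k t) := fun k t ht => Nat.sInf_mem (hcover k t ht)
  have hF : ∀ k, AEMeasurable (fun t => P.h t (q (idx k t)).1 (q (idx k t)).2 (u t))
      P.timeMeasure := by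
    intro k
    let D : ℕ → Set ℝ := fun i => A k i \ ⋃ (j) (_ : j < i), A k j
    have hD : ∀ i, MeasurableSet (D i) := fun i =>
      (hA k i).diff (MeasurableSet.iUnion fun j => MeasurableSet.iUnion fun _ => hA k j)
    have hDidx : ∀ i, ∀ t ∈ D i, idx k t = i := by
      rintro i t ⟨hti, hlt⟩
      refine le_antisymm (Nat.sInf_le hti) ?_
      by_contra hcon
      exact hlt (mem_iUnion₂.2 ⟨_, not_le.1 hcon, Nat.sInf_mem (s := {i | t ∈ A k i}) ⟨i, hti⟩⟩)
    have hsub : Icc 0 P.T ⊆ ⋃ i, D i := by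
      intro t ht
      refine mem_iUnion.2 ⟨idx k t, hidx k t ht, fun hcon => ?_⟩
      obtain ⟨j, hj, hjt⟩ := mem_iUnion₂.1 hcon
      exact Nat.notMem_of_lt_sInf hj hjt
    have hall : AEMeasurable (fun t => P.h t (q (idx k t)).1 (q (idx k t)).2 (u t))
        (volume.restrict (⋃ i, D i)) := by
      refine aemeasurable_iUnion_iff.2 fun i => ?_
      refine ((hmeas (q i).1 (q i).2 u hu).mono_measure
        (Measure.restrict_mono_set _ fun t ht => ht.1.1)).congr ?_
      refine ae_restrict_of_forall_mem (hD i) fun t ht => ?_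
      simp only [hDidx i t ht]
    exact hall.mono_measure (Measure.restrict_mono_set _ hsub)
  refine aemeasurable_of_tendsto_metrizable_ae atTop hF ?_
  have hIcc : ∀ᵐ t ∂P.timeMeasure, t ∈ Icc 0 P.T := ae_restrict_mem measurableSet_Icc
  filter_upwards [hcont, hu.2, hIcc] with t ht hut htI
  have hlim : Tendsto (fun k => q (idx k t)) atTop (𝓝 (x t, y t)) := by
    rw [tendsto_iff_dist_tendsto_zero]
    refine squeeze_zero (fun _ => dist_nonneg) (fun k => ?_)
      tendsto_one_div_add_atTop_nhds_zero_nat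
    rw [dist_comm]
    exact (hidx k t htI).2.1.le
  have hlim' : Tendsto (fun k => ((q (idx k t)).1, (q (idx k t)).2, u t)) atTop
      (𝓝[P.C t ×ˢ univ ×ˢ P.U t] (x t, y t, u t)) := by
    refine tendsto_nhdsWithin_iff.2 ⟨?_, Eventually.of_forall fun k =>
      ⟨(hidx k t htI).1.2, mem_univ _, hut⟩⟩
    exact (((continuous_fst.tendsto _).comp hlim).prodMk_nhds
      (((continuous_snd.tendsto _).comp hlim).prodMk_nhds tendsto_const_nhds))
  exact (ht (x t, y t, u t) ⟨hxC t htI, mem_univ _, hut⟩).tendsto.comp hlim'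

/-- Filippov's lemma for the velocity sets `h (t, x t, y t, U(t))`. -/
theorem exists_control_eq
    (hψ : ∀ i, ContinuousOn (fun q : ℝ × Vec n => P.ψ i q.1 q.2) (Icc 0 P.T ×ˢ univ))
    (hint : ∀ q ∈ P.graphC, q.2 ∈ closure {c | ∀ i, P.ψ i q.1 c < 0})
    (hmeas : ∀ x y, ∀ u ∈ P.controls, AEMeasurable (fun t => P.h t x y (u t))
      (volume.restrict {t | (t, x) ∈ P.graphC}))
    (hcont : ∀ᵐ t ∂P.timeMeasure, ContinuousOn
      (fun q : Vec n × Vec l × Vec m => P.h t q.1 q.2.1 q.2.2) (P.C t ×ˢ univ ×ˢ P.U t))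
    (hU_meas : P.MeasurableControlSets) (hU_compact : ∀ t ∈ Icc 0 P.T, IsCompact (P.U t))
    {x : ℝ → Vec n} {y : ℝ → Vec l}
    (hx : ContinuousOn x (Icc 0 P.T)) (hy : ContinuousOn y (Icc 0 P.T))
    (hxC : ∀ t ∈ Icc 0 P.T, x t ∈ P.C t)
    {z : ℝ → WithLp 2 (Vec n × Vec l)} (hz : AEMeasurable z P.timeMeasure)
    (hzU : ∀ᵐ t ∂P.timeMeasure, z t ∈ P.h t (x t) (y t) '' P.U t) :
    ∃ u ∈ P.controls, ∀ᵐ t ∂P.timeMeasure, P.h t (x t) (y t) (u t) = z t := by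
  classical
  -- off the null set where the hypotheses fail, the data are replaced by trivial ones
  let G : Set ℝ := {t | t ∈ Icc 0 P.T ∧ ContinuousOn (P.h t (x t) (y t)) (P.U t) ∧
    z t ∈ P.h t (x t) (y t) '' P.U t}
  have hIcc : ∀ᵐ t ∂P.timeMeasure, t ∈ Icc 0 P.T := ae_restrict_mem measurableSet_Icc
  have hG : ∀ᵐ t ∂P.timeMeasure, t ∈ G := by
    filter_upwards [hIcc, hcont, hzU] with t ht hc hzt
    refine ⟨ht, ?_, hzt⟩
    exact hc.comp (f := fun v : Vec m => (x t, y t, v)) (by fun_prop)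
      fun v hv => ⟨hxC t ht, mem_univ _, hv⟩
  let W : NullMeasurableSpace ℝ P.timeMeasure → Set (Vec m) := fun t => if t ∈ G then P.U t else {0}
  let H : NullMeasurableSpace ℝ P.timeMeasure → Vec m → WithLp 2 (Vec n × Vec l) :=
    fun t v => if t ∈ G then P.h t (x t) (y t) v else z t
  have hWG : ∀ t ∈ G, W t = P.U t := fun t ht => if_pos ht
  have hHG : ∀ t ∈ G, ∀ v, H t v = P.h t (x t) (y t) v := fun t ht v => if_pos ht
  have hWn : ∀ t ∉ G, W t = {0} := fun t ht => if_neg ht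
  have hHn : ∀ t ∉ G, ∀ v, H t v = z t := fun t ht v => if_neg ht
  have hctrl : ∀ w : NullMeasurableSpace ℝ P.timeMeasure → Vec m, Measurable w →
      (∀ t, w t ∈ W t) → (w : ℝ → Vec m) ∈ P.controls := by
    intro w hw hwW
    have hnull : NullMeasurable (α := ℝ) w P.timeMeasure := fun s hs => hw hs
    refine ⟨hnull.aemeasurable, ?_⟩
    filter_upwards [hG] with t ht
    have := hwW t
    rwa [hWG t ht] at this
  obtain ⟨w, hw, hwW⟩ := exists_measurable_selection_eq (W := W) (H := H) (z := z)
    (fun t => by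
      by_cases ht : t ∈ G
      · rw [hWG t ht]; exact hU_compact t ht.1
      · rw [hWn t ht]; exact isCompact_singleton)
    (fun O hO => by
      have h1 : NullMeasurableSet {t | t ∈ Icc 0 P.T ∧ (P.U t ∩ O).Nonempty} P.timeMeasure :=
        (hU_meas O hO).mono Measure.restrict_le_self
      refine NullMeasurableSet.congr h1 ?_
      filter_upwards [hG] with t ht
      refine propext ?_
      change (t ∈ Icc 0 P.T ∧ (P.U t ∩ O).Nonempty) ↔ (W t ∩ O).Nonempty
      rw [hWG t ht]
      exact and_iff_right ht.1)
    (fun t => by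
      by_cases ht : t ∈ G
      · rw [hWG t ht]; exact ht.2.1.congr fun v _ => hHG t ht v
      · rw [hWn t ht]; exact continuousOn_singleton _ _)
    (fun w hw hwW => by
      have h1 := (aemeasurable_h_comp hψ hint hmeas hcont hx hy hxC (hctrl w hw hwW))
      have h2 : AEMeasurable (fun t : ℝ => H t (w t)) P.timeMeasure := by
        refine h1.congr ?_
        filter_upwards [hG] with t ht using (hHG t ht _).symm
      exact h2.nullMeasurable.measurable')
    hz.nullMeasurable.measurable'
    (fun t => by
      by_cases ht : t ∈ G
      · obtain ⟨v, hv, hvz⟩ := ht.2.2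
        exact ⟨v, by rwa [hWG t ht], by rw [hHG t ht, hvz]⟩
      · exact ⟨0, by rw [hWn t ht]; rfl, hHn t ht 0⟩)
  refine ⟨w, hctrl w hw fun t => (hwW t).1, ?_⟩
  filter_upwards [hG] with t ht
  rw [← hHG t ht]
  exact (hwW t).2

end Problem

/-! ### Absolutely continuous curves -/

/-- `z` is absolutely continuous on `[0,T]` with derivative `z'`: `HasW11Deriv` for curves in an
arbitrary normed space. -/
def IsPrimitive {F : Type*} [NormedAddCommGroup F] [NormedSpace ℝ F] (T : ℝ) (z z' : ℝ → F) :
    Prop :=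
  IntegrableOn z' (Icc 0 T) ∧ ∀ t ∈ Icc 0 T, z t = z 0 + ∫ s in (0 : ℝ)..t, z' s

namespace IsPrimitive

variable {F G : Type*} [NormedAddCommGroup F] [NormedSpace ℝ F]
  [NormedAddCommGroup G] [NormedSpace ℝ G] {T : ℝ} {z z' w w' : ℝ → F}

theorem intervalIntegrable (h : IsPrimitive T z z') {a b : ℝ} (ha : a ∈ Icc 0 T)
    (hb : b ∈ Icc 0 T) : IntervalIntegrable z' volume a b := by
  have hT : 0 ≤ T := ha.1.trans ha.2
  refine ((intervalIntegrable_iff_integrableOn_Icc_of_le hT).2 h.1).mono_set ?_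
  rw [uIcc_of_le hT]
  exact uIcc_subset_Icc ha hb

theorem sub_eq (h : IsPrimitive T z z') {a b : ℝ} (ha : a ∈ Icc 0 T) (hb : b ∈ Icc 0 T) :
    z b - z a = ∫ s in a..b, z' s := by
  have h0 : (0 : ℝ) ∈ Icc 0 T := ⟨le_rfl, ha.1.trans ha.2⟩
  rw [h.2 b hb, h.2 a ha, add_sub_add_left_eq_sub,
    intervalIntegral.integral_interval_sub_left (h.intervalIntegrable h0 hb)
      (h.intervalIntegrable h0 ha)]

theorem ae_hasDerivAt [CompleteSpace F] (h : IsPrimitive T z z') :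
    ∀ᵐ t ∂volume.restrict (Icc 0 T), HasDerivAt z (z' t) t := by
  rcases lt_or_ge T 0 with hT | hT
  · simp [Icc_eq_empty (not_le.2 hT)]
  have h0 : ∀ᵐ x : ℝ, x ≠ 0 := by simp [ae_iff, measure_singleton]
  have h1 : ∀ᵐ x : ℝ, x ≠ T := by simp [ae_iff, measure_singleton]
  have hii := h.intervalIntegrable ⟨le_rfl, hT⟩ ⟨hT, le_rfl⟩
  rw [ae_restrict_iff' measurableSet_Icc]
  filter_upwards [hii.ae_hasDerivAt_integral, h0, h1] with t ht ht0 ht1 htT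
  rw [uIcc_of_le hT] at ht
  refine ((ht htT 0 ⟨le_rfl, hT⟩).const_add (z 0)).congr_of_eventuallyEq ?_
  filter_upwards [Icc_mem_nhds (lt_of_le_of_ne htT.1 (Ne.symm ht0))
    (lt_of_le_of_ne htT.2 ht1)] with s hs using h.2 s hs

theorem lipschitzOnWith (h : IsPrimitive T z z') {K : ℝ}
    (hK : ∀ᵐ t ∂volume.restrict (Icc 0 T), ‖z' t‖ ≤ K) (hK0 : 0 ≤ K) :
    LipschitzOnWith K.toNNReal z (Icc 0 T) := by
  refine LipschitzOnWith.of_dist_le_mul fun b hb a ha => ?_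
  rw [dist_eq_norm, h.sub_eq ha hb, Real.coe_toNNReal _ hK0, Real.dist_eq]
  refine intervalIntegral.norm_integral_le_of_norm_le_const_ae ?_
  rw [ae_restrict_iff' measurableSet_Icc] at hK
  filter_upwards [hK] with s hs hsab
  exact hs (uIcc_subset_Icc ha hb (uIoc_subset_uIcc hsab))

theorem congr_ae (h : IsPrimitive T z z') (hw : z' =ᵐ[volume.restrict (Icc 0 T)] w') :
    IsPrimitive T z w' := by
  refine ⟨h.1.congr hw, fun t ht => ?_⟩
  rw [h.2 t ht]
  congr 1
  refine intervalIntegral.integral_congr_ae ?_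
  filter_upwards [(ae_restrict_iff' measurableSet_Icc).1 hw] with s hs hst
  have h0 : (0 : ℝ) ∈ Icc 0 T := ⟨le_rfl, ht.1.trans ht.2⟩
  exact hs (uIcc_subset_Icc h0 ht (uIoc_subset_uIcc hst))

theorem sub (h : IsPrimitive T z z') (h₁ : IsPrimitive T w w') :
    IsPrimitive T (fun t => z t - w t) (fun t => z' t - w' t) := by
  refine ⟨h.1.sub h₁.1, fun t ht => ?_⟩
  have h0 : (0 : ℝ) ∈ Icc 0 T := ⟨le_rfl, ht.1.trans ht.2⟩
  rw [intervalIntegral.integral_sub (h.intervalIntegrable h0 ht) (h₁.intervalIntegrable h0 ht),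
    ← h.sub_eq h0 ht, ← h₁.sub_eq h0 ht]
  module

theorem map [CompleteSpace F] [CompleteSpace G] (h : IsPrimitive T z z') (A : F →L[ℝ] G) :
    IsPrimitive T (fun t => A (z t)) (fun t => A (z' t)) := by
  refine ⟨A.integrable_comp h.1, fun t ht => ?_⟩
  have h0 : (0 : ℝ) ∈ Icc 0 T := ⟨le_rfl, ht.1.trans ht.2⟩
  rw [A.intervalIntegral_comp_comm (h.intervalIntegrable h0 ht), ← h.sub_eq h0 ht, map_sub]
  module

end IsPrimitive

theorem Icc_subset_closure_of_ae {T : ℝ} (hT : 0 < T) {S : Set ℝ}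
    (hS : ∀ᵐ t ∂volume.restrict (Icc 0 T), t ∈ S) : Icc 0 T ⊆ closure (S ∩ Icc 0 T) := by
  intro t ht
  rw [← closure_Ioo hT.ne] at ht
  refine mem_closure_iff.2 fun O hO htO => ?_
  have hne := mem_closure_iff.1 ht O hO htO
  by_contra hcon
  have hzero : volume (O ∩ Ioo 0 T) = 0 := by
    have hsub : O ∩ Ioo 0 T ⊆ {s | ¬(s ∈ Icc 0 T → s ∈ S)} := by
      rintro s ⟨hsO, hsT⟩ hcs
      have hsI := Ioo_subset_Icc_self hsT
      exact hcon ⟨s, hsO, hcs hsI, hsI⟩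
    exact measure_mono_null hsub (ae_iff.1 ((ae_restrict_iff' measurableSet_Icc).1 hS))
  exact ((hO.inter isOpen_Ioo).measure_pos volume hne).ne' hzero

/-- Convergence of primitives puts the limit velocity in the closed convex hull of the approximating
velocities. The support function of that hull is replaced by the supremum of countably many
measurable functions, so that no measurability of the hull is needed. -/
theorem mem_of_tendsto_integral {F : Type*} [NormedAddCommGroup F] [InnerProductSpace ℝ F]
    [FiniteDimensional ℝ F] {T M : ℝ} {v : ℕ → ℝ → F} {z : ℝ → F}
    (hv : ∀ j, AEStronglyMeasurable (v j) (volume.restrict (Icc 0 T)))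
    (hM : ∀ j, ∀ᵐ t ∂volume.restrict (Icc 0 T), ‖v j t‖ ≤ M)
    (hlim : ∀ t ∈ Icc 0 T, Tendsto (fun j => ∫ s in (0 : ℝ)..t, v j s) atTop (𝓝 (z t))) :
    ∀ᵐ t ∂volume.restrict (Icc 0 T), ∀ w, HasDerivAt z w t →
      ∀ S : Set F, Convex ℝ S → IsClosed S → (∀ j, v j t ∈ S) → w ∈ S := by
  have : CompleteSpace F := FiniteDimensional.complete ℝ F
  let q := TopologicalSpace.denseSeq F
  have hq : DenseRange q := TopologicalSpace.denseRange_denseSeq F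
  rcases le_or_gt T 0 with hT | hT
  · have : volume (Icc 0 T) = 0 := by simp [hT]
    rw [Measure.restrict_eq_zero.2 this]
    simp
  have hM' : ∀ᵐ t ∂volume.restrict (Icc 0 T), ∀ j, ‖v j t‖ ≤ M := ae_all_iff.2 hM
  -- support function in the direction `p`
  let σ : F → ℝ → ℝ := fun p t => ⨆ j, inner ℝ p (v j t)
  have hinner : ∀ (p : F) (t : ℝ), (∀ j, ‖v j t‖ ≤ M) → ∀ j, |inner ℝ p (v j t)| ≤ ‖p‖ * M :=
    fun p t ht j =>
      (abs_real_inner_le_norm _ _).trans (mul_le_mul_of_nonneg_left (ht j) (norm_nonneg _))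
  have hbdd : ∀ (p : F) (t : ℝ), (∀ j, ‖v j t‖ ≤ M) →
      BddAbove (range fun j => inner ℝ p (v j t)) := fun p t ht =>
    ⟨‖p‖ * M, by rintro _ ⟨j, rfl⟩; exact (le_abs_self _).trans (hinner p t ht j)⟩
  have hσint : ∀ p, IntegrableOn (σ p) (Icc 0 T) := by
    intro p
    refine Integrable.of_bound ?_ (‖p‖ * M) ?_
    · refine (AEMeasurable.iSup fun j => ?_).aestronglyMeasurable
      exact ((hv j).const_inner (𝕜 := ℝ) (c := p)).aemeasurable
    · filter_upwards [hM'] with t ht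
      refine abs_le.2 ⟨?_, ciSup_le fun j => (le_abs_self _).trans (hinner p t ht j)⟩
      exact (abs_le.1 (hinner p t ht 0)).1.trans (le_ciSup (hbdd p t ht) 0)
  have hvint : ∀ j, IntegrableOn (v j) (Icc 0 T) := fun j =>
    Integrable.of_bound (hv j) M (hM j)
  have hprimσ : ∀ p, IsPrimitive T (fun t => ∫ s in (0 : ℝ)..t, σ p s) (σ p) := fun p =>
    ⟨hσint p, fun t _ => by simp⟩
  have hprimv : ∀ j, IsPrimitive T (fun t => ∫ s in (0 : ℝ)..t, v j s) (v j) := fun j =>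
    ⟨hvint j, fun t _ => by simp⟩
  have hmono : ∀ p, ∀ a ∈ Icc 0 T, ∀ b ∈ Icc 0 T, a ≤ b →
      inner ℝ p (z b - z a) ≤ (∫ s in (0 : ℝ)..b, σ p s) - ∫ s in (0 : ℝ)..a, σ p s := by
    intro p a ha b hb hab
    have h1 : Tendsto (fun j => inner ℝ p ((∫ s in (0 : ℝ)..b, v j s) - ∫ s in (0 : ℝ)..a, v j s))
        atTop (𝓝 (inner ℝ p (z b - z a))) :=
      tendsto_const_nhds.inner ((hlim b hb).sub (hlim a ha))
    refine le_of_tendsto' h1 fun j => ?_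
    have h2 := (hprimv j).sub_eq ha hb
    have h3 := (hprimσ p).sub_eq ha hb
    have hvab := (hprimv j).intervalIntegrable ha hb
    rw [h2, h3]
    have h4 := (innerSL ℝ p).intervalIntegral_comp_comm hvab
    simp only [innerSL_apply_apply] at h4
    rw [← h4]
    refine intervalIntegral.integral_mono_ae_restrict hab
      ((((hprimv j).map (innerSL ℝ p)).intervalIntegrable ha hb))
      ((hprimσ p).intervalIntegrable ha hb) ?_
    filter_upwards [ae_mono (Measure.restrict_mono_set volume (Icc_subset_Icc ha.1 hb.2)) hM']
      with s hs
    exact le_ciSup (hbdd p s hs) j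
  have hder : ∀ᵐ t ∂volume.restrict (Icc 0 T), ∀ i,
      HasDerivAt (fun t => ∫ s in (0 : ℝ)..t, σ (q i) s) (σ (q i) t) t :=
    ae_all_iff.2 fun i => (hprimσ (q i)).ae_hasDerivAt
  have hIoo : ∀ᵐ t ∂volume.restrict (Icc 0 T), t ∈ Ioo 0 T := by
    rw [← Measure.restrict_congr_set Ioo_ae_eq_Icc]
    exact ae_restrict_mem measurableSet_Ioo
  filter_upwards [hder, hM', hIoo] with t ht htM htI w hw S hSc hScl hvS
  have htT := Ioo_subset_Icc_self htI
  have hle : ∀ i, inner ℝ (q i) w ≤ σ (q i) t := by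
    intro i
    have h1 : HasDerivAt (fun t => inner ℝ (q i) (z t)) (inner ℝ (q i) w) t := by
      simpa using! (innerSL ℝ (q i)).hasFDerivAt.comp_hasDerivAt t hw
    have h2 := (hasDerivAt_iff_tendsto_slope_left_right.1 ((ht i).fun_sub h1)).2
    have h3 : 0 ≤ σ (q i) t - inner ℝ (q i) w := by
      refine ge_of_tendsto h2 ?_
      filter_upwards [Ioo_mem_nhdsGT htI.2] with s hs
      have h4 := hmono (q i) t htT s ⟨htI.1.le.trans hs.1.le, hs.2.le⟩ hs.1.le
      rw [inner_sub_right] at h4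
      rw [slope_def_field]
      exact div_nonneg (by linarith) (sub_nonneg.2 hs.1.le)
    linarith
  by_contra hwS
  obtain ⟨p, s, hp, hs⟩ := geometric_hahn_banach_closed_point hSc hScl hwS
  set p' := (InnerProductSpace.toDual ℝ F).symm p with hp'
  have hpp : ∀ e, inner ℝ p' e = p e := fun e => by
    rw [hp', InnerProductSpace.toDual_symm_apply]
  have hM0 : 0 ≤ M := (norm_nonneg _).trans (htM 0)
  have hpos : 0 < (p w - s) / (M + ‖w‖ + 1) := div_pos (sub_pos.2 hs) (by positivity)
  obtain ⟨i, hi⟩ := hq.exists_dist_lt p' hpos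
  rw [dist_eq_norm, lt_div_iff₀ (by positivity)] at hi
  have hsup : σ (q i) t ≤ s + ‖p' - q i‖ * M := by
    refine ciSup_le fun j => ?_
    have h1 := hp _ (hvS j)
    have h2 := (abs_le.1 (abs_real_inner_le_norm (p' - q i) (v j t))).1
    have h3 := mul_le_mul_of_nonneg_left (htM j) (norm_nonneg (p' - q i))
    rw [inner_sub_left, hpp] at h2
    linarith
  have h1 := hle i
  have h2 := (abs_le.1 (abs_real_inner_le_norm (p' - q i) w)).2
  rw [inner_sub_left, hpp] at h2
  have h3 := norm_nonneg (p' - q i)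
  nlinarith

/-! ### Trajectories of the controlled sweeping process -/

namespace Problem

variable {n l m r : ℕ} {P : Problem n l m r}

/-- The hypotheses on the data with their constants: regularity of the generators (`ρ`, `L`), the
uniform modulus `η` of the constraint qualification, and the bounds `M`, `Λ` on the dynamics. -/
structure IsRegular (P : Problem n l m r) (ρ L η M : ℝ) (Λ : ℝ → ℝ) : Prop where
  T_pos : 0 < P.T
  ρ_pos : 0 < ρ
  L_pos : 0 < L
  η_pos : 0 < η
  M_pos : 0 < M
  ψ_cont : ∀ i, ContinuousOn (fun q : ℝ × Vec n => P.ψ i q.1 q.2) (Icc 0 P.T ×ˢ univ)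
  regular : P.RegularWith ρ L
  bounded : Bornology.IsBounded P.graphC
  inward : ∀ q ∈ P.graphC, ∃ v, P.IsInward η q.1 q.2 v
  U_meas : P.MeasurableControlSets
  U_compact : ∀ t ∈ Icc 0 P.T, IsCompact (P.U t)
  h_meas : ∀ x y, ∀ u ∈ P.controls, AEMeasurable (fun t => P.h t x y (u t))
      (volume.restrict {t | (t, x) ∈ P.graphC})
  h_cont : ∀ᵐ t ∂P.timeMeasure, ContinuousOn
      (fun q : Vec n × Vec l × Vec m => P.h t q.1 q.2.1 q.2.2) (P.C t ×ˢ univ ×ˢ P.U t)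
  h_bound : ∀ᵐ t ∂P.timeMeasure, ∀ x ∈ P.C t, ∀ y, ∀ u ∈ P.U t, ‖P.h t x y u‖ ≤ M
  h_lip : ∀ᵐ t ∂P.timeMeasure, ∀ x ∈ P.C t, ∀ y, ∀ x₁ ∈ P.C t, ∀ y₁, ∀ u ∈ P.U t,
      ‖P.h t x y u - P.h t x₁ y₁ u‖ ≤
        Λ t * ‖(WithLp.toLp 2 (x, y) - WithLp.toLp 2 (x₁, y₁) : WithLp 2 (Vec n × Vec l))‖
  h_convex : P.ConvexVelocities

theorem ae_mem_Icc : ∀ᵐ t ∂P.timeMeasure, t ∈ Icc 0 P.T := ae_restrict_mem measurableSet_Icc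

namespace IsRegular

variable {ρ L η M : ℝ} {Λ : ℝ → ℝ}

theorem mem_closure (hP : P.IsRegular ρ L η M Λ) :
    ∀ q ∈ P.graphC, q.2 ∈ closure {c | ∀ i, P.ψ i q.1 c < 0} := fun q hq => by
  obtain ⟨v, hv⟩ := hP.inward q hq
  exact mem_closure_strict hP.regular hP.ρ_pos hP.ψ_cont hP.η_pos hq hv

theorem aemeasurable_h (hP : P.IsRegular ρ L η M Λ) {x : ℝ → Vec n} {y : ℝ → Vec l}
    {u : ℝ → Vec m} (hx : ContinuousOn x (Icc 0 P.T)) (hy : ContinuousOn y (Icc 0 P.T))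
    (hxC : ∀ t ∈ Icc 0 P.T, x t ∈ P.C t) (hu : u ∈ P.controls) :
    AEMeasurable (fun t => P.h t (x t) (y t) (u t)) P.timeMeasure :=
  aemeasurable_h_comp hP.ψ_cont hP.mem_closure hP.h_meas hP.h_cont hx hy hxC hu

/-- A trajectory stays in `C(·)`, and its velocity is `f - ν` with uniformly bounded normal
vectors `ν`. -/
theorem exists_normal (hP : P.IsRegular ρ L η M Λ) {x : ℝ → Vec n} {y : ℝ → Vec l}
    {u : ℝ → Vec m} (hu : u ∈ P.controls) (h : P.SolvesDynamics x y u) :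
    (∀ t ∈ Icc 0 P.T, x t ∈ P.C t) ∧ ∃ ν : ℝ → Vec n,
      (∀ᵐ t ∂P.timeMeasure, ν t ∈ clarkeNormalCone (P.C t) (x t) ∧ ‖ν t‖ ≤ M + L / η) ∧
      IsPrimitive P.T x (fun t => P.f t (x t) (y t) (u t) - ν t) ∧
      IsPrimitive P.T y (fun t => P.g t (x t) (y t) (u t)) := by
  obtain ⟨x', y', hx, hy, hxν, hyg⟩ := h
  have hx : IsPrimitive P.T x x' := hx
  have hy : IsPrimitive P.T y y' := hy
  have hxcont : ContinuousOn x (Icc 0 P.T) := by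
    have hii := intervalIntegral.continuousOn_primitive hx.1
    refine ((continuousOn_const (c := x 0)).add hii).congr fun t ht => ?_
    rw [hx.2 t ht, intervalIntegral.integral_of_le ht.1, Pi.add_apply]
  have hxC : ∀ t ∈ Icc 0 P.T, x t ∈ P.C t := by
    intro t ht
    have hae : ∀ᵐ t ∂volume.restrict (Icc 0 P.T), t ∈ {t | x t ∈ P.C t} := by
      filter_upwards [hxν] with t ht
      obtain ⟨ν, hν, -⟩ := ht
      exact hν.1
    obtain ⟨s, hs, hst⟩ := mem_closure_iff_seq_limit.1 (Icc_subset_closure_of_ae hP.T_pos hae ht)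
    have hlim : Tendsto (fun j => (s j, x (s j))) atTop (𝓝 (t, x t)) :=
      hst.prodMk_nhds ((hxcont t ht).tendsto.comp (tendsto_nhdsWithin_iff.2
        ⟨hst, Eventually.of_forall fun j => (hs j).2⟩))
    exact ((isClosed_graphC hP.ψ_cont).mem_of_tendsto hlim
      (Eventually.of_forall fun j => ⟨(hs j).2, (hs j).1⟩)).2
  refine ⟨hxC, fun t => P.f t (x t) (y t) (u t) - x' t, ?_, ?_, hy.congr_ae hyg⟩
  · have hpos : ∀ᵐ t ∂P.timeMeasure, t ∈ Ioc 0 P.T := by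
      rw [timeMeasure, ← Measure.restrict_congr_set Ioc_ae_eq_Icc]
      exact ae_restrict_mem measurableSet_Ioc
    filter_upwards [hxν, hx.ae_hasDerivAt, hP.h_bound, hu.2, hpos] with t ⟨ν, hν, hxt⟩ hd hb hut htI
    have e : P.f t (x t) (y t) (u t) - x' t = ν := by rw [hxt]; abel
    rw [e]
    refine ⟨hν, ?_⟩
    obtain ⟨v, hv⟩ := hP.inward (t, x t) ⟨⟨htI.1.le, htI.2⟩, hν.1⟩
    have hφ : ‖P.f t (x t) (y t) (u t)‖ ≤ M :=
      (WithLp.norm_fst_le _ (P.h t (x t) (y t) (u t))).trans (hb _ hν.1 _ _ hut)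
    exact norm_le_of_hasDerivAt hP.regular hP.ρ_pos hP.L_pos.le hP.ψ_cont hP.η_pos htI.1 htI.2 hxC
      (hxt ▸ hd) hv hν hφ
  · simpa using hx

end IsRegular

/-! ### Closedness of the set of trajectories -/

namespace IsRegular

variable {ρ L η M : ℝ} {Λ : ℝ → ℝ}

/-- Velocity inclusion for the limit: if the primitives of the velocities `h (t, x j, y j, u j)`
converge, the limit velocity lies in `h (t, x t, y t, U(t))`. -/
theorem ae_mem_image (hP : P.IsRegular ρ L η M Λ)
    {x : ℕ → ℝ → Vec n} {y : ℕ → ℝ → Vec l} {u : ℕ → ℝ → Vec m}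
    {x₀ : ℝ → Vec n} {y₀ : ℝ → Vec l} {z₀ : ℝ → WithLp 2 (Vec n × Vec l)}
    (hx : ∀ j, ContinuousOn (x j) (Icc 0 P.T)) (hy : ∀ j, ContinuousOn (y j) (Icc 0 P.T))
    (hx₀ : ContinuousOn x₀ (Icc 0 P.T)) (hy₀ : ContinuousOn y₀ (Icc 0 P.T))
    (hxC : ∀ j, ∀ t ∈ Icc 0 P.T, x j t ∈ P.C t) (hx₀C : ∀ t ∈ Icc 0 P.T, x₀ t ∈ P.C t)
    (hu : ∀ j, u j ∈ P.controls)
    (hxlim : ∀ t ∈ Icc 0 P.T, Tendsto (fun j => x j t) atTop (𝓝 (x₀ t)))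
    (hylim : ∀ t ∈ Icc 0 P.T, Tendsto (fun j => y j t) atTop (𝓝 (y₀ t)))
    (hzlim : ∀ t ∈ Icc 0 P.T, Tendsto
      (fun j => ∫ s in (0 : ℝ)..t, P.h s (x j s) (y j s) (u j s)) atTop (𝓝 (z₀ t)))
    {z' : ℝ → WithLp 2 (Vec n × Vec l)} (hz : IsPrimitive P.T z₀ z') :
    ∀ᵐ t ∂P.timeMeasure, z' t ∈ P.h t (x₀ t) (y₀ t) '' P.U t := by
  have hmeas : ∀ j, AEStronglyMeasurable (fun s => P.h s (x j s) (y j s) (u j s)) P.timeMeasure :=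
    fun j => (hP.aemeasurable_h (hx j) (hy j) (hxC j) (hu j)).aestronglyMeasurable
  have hmeas₀ : ∀ j, AEStronglyMeasurable (fun s => P.h s (x₀ s) (y₀ s) (u j s)) P.timeMeasure :=
    fun j => (hP.aemeasurable_h hx₀ hy₀ hx₀C (hu j)).aestronglyMeasurable
  have hbd : ∀ j, ∀ᵐ t ∂P.timeMeasure, ‖P.h t (x j t) (y j t) (u j t)‖ ≤ M := fun j => by
    filter_upwards [hP.h_bound, (hu j).2, ae_mem_Icc] with t hb hut ht
    exact hb _ (hxC j t ht) _ _ hut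
  have hbd₀ : ∀ j, ∀ᵐ t ∂P.timeMeasure, ‖P.h t (x₀ t) (y₀ t) (u j t)‖ ≤ M := fun j => by
    filter_upwards [hP.h_bound, (hu j).2, ae_mem_Icc] with t hb hut ht
    exact hb _ (hx₀C t ht) _ _ hut
  have hfin : IsFiniteMeasure P.timeMeasure := by unfold timeMeasure; infer_instance
  have hprim : ∀ j, IsPrimitive P.T
      (fun t => ∫ s in (0 : ℝ)..t, P.h s (x j s) (y j s) (u j s))
      (fun s => P.h s (x j s) (y j s) (u j s)) := fun j =>
    ⟨Integrable.of_bound (hmeas j) M (hbd j), fun t _ => by simp⟩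
  have hprim₀ : ∀ j, IsPrimitive P.T
      (fun t => ∫ s in (0 : ℝ)..t, P.h s (x₀ s) (y₀ s) (u j s))
      (fun s => P.h s (x₀ s) (y₀ s) (u j s)) := fun j =>
    ⟨Integrable.of_bound (hmeas₀ j) M (hbd₀ j), fun t _ => by simp⟩
  have hall : ∀ᵐ t ∂P.timeMeasure, ∀ j, u j t ∈ P.U t := ae_all_iff.2 fun j => (hu j).2
  -- freezing the state at the limit curve does not change the limit of the primitives
  have hzlim₀ : ∀ t ∈ Icc 0 P.T, Tendsto
      (fun j => ∫ s in (0 : ℝ)..t, P.h s (x₀ s) (y₀ s) (u j s)) atTop (𝓝 (z₀ t)) := by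
    intro t ht
    have h0 : (0 : ℝ) ∈ Icc 0 P.T := ⟨le_rfl, ht.1.trans ht.2⟩
    have hsub : uIoc 0 t ⊆ Icc 0 P.T := uIoc_subset_uIcc.trans (uIcc_subset_Icc h0 ht)
    have hrest : ∀ {p : ℝ → Prop}, (∀ᵐ s ∂P.timeMeasure, p s) → ∀ᵐ s, s ∈ uIoc 0 t → p s := by
      intro p hp
      filter_upwards [(ae_restrict_iff' measurableSet_Icc).1 hp] with s hs hst using hs (hsub hst)
    have hdiff : Tendsto (fun j => ∫ s in (0 : ℝ)..t,
        (P.h s (x₀ s) (y₀ s) (u j s) - P.h s (x j s) (y j s) (u j s))) atTop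
        (𝓝 (∫ _s in (0 : ℝ)..t, (0 : WithLp 2 (Vec n × Vec l)))) := by
      refine intervalIntegral.tendsto_integral_filter_of_dominated_convergence (fun _ => M + M)
        (Eventually.of_forall fun j => ((hmeas₀ j).sub (hmeas j)).mono_measure
          (Measure.restrict_mono_set _ hsub)) (Eventually.of_forall fun j => hrest ?_)
        intervalIntegrable_const (hrest ?_)
      · filter_upwards [hbd j, hbd₀ j] with s h1 h2
        exact (norm_sub_le _ _).trans (add_le_add h2 h1)
      · filter_upwards [hall, hP.h_lip, ae_mem_Icc] with s hus hlip hs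
        rw [tendsto_zero_iff_norm_tendsto_zero]
        have hpair : Tendsto (fun j => Λ s * ‖(WithLp.toLp 2 (x₀ s, y₀ s) -
            WithLp.toLp 2 (x j s, y j s) : WithLp 2 (Vec n × Vec l))‖) atTop (𝓝 0) := by
          have h1 : Tendsto (fun j => (WithLp.toLp 2 (x j s, y j s) : WithLp 2 (Vec n × Vec l)))
              atTop (𝓝 (WithLp.toLp 2 (x₀ s, y₀ s))) :=
            ((WithLp.prod_continuous_toLp 2 (Vec n) (Vec l)).tendsto _).comp
              ((hxlim s hs).prodMk_nhds (hylim s hs))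
          have h2 := (((tendsto_const_nhds (x := (WithLp.toLp 2 (x₀ s, y₀ s) :
            WithLp 2 (Vec n × Vec l)))).sub h1).norm).const_mul (Λ s)
          rwa [sub_self, norm_zero, mul_zero] at h2
        exact squeeze_zero (fun _ => norm_nonneg _)
          (fun j => hlip _ (hx₀C s hs) _ _ (hxC j s hs) _ _ (hus j)) hpair
    have hsum := hdiff.add (hzlim t ht)
    simp only [intervalIntegral.integral_zero, zero_add] at hsum
    refine hsum.congr fun j => ?_
    rw [intervalIntegral.integral_sub ((hprim₀ j).intervalIntegrable h0 ht)
      ((hprim j).intervalIntegrable h0 ht), sub_add_cancel]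
  filter_upwards [mem_of_tendsto_integral hmeas₀ hbd₀ hzlim₀, hz.ae_hasDerivAt, hall,
    hP.h_convex, hP.h_cont, ae_mem_Icc] with t hmem hzt hut hconv hcont ht
  refine hmem _ hzt _ (hconv _ (hx₀C t ht) _) ?_ fun j => mem_image_of_mem _ (hut j)
  refine ((hP.U_compact t ht).image_of_continuousOn ?_).isClosed
  exact hcont.comp (f := fun v : Vec m => (x₀ t, y₀ t, v)) (by fun_prop)
    fun v hv => ⟨hx₀C t ht, mem_univ _, hv⟩

/-- Closedness of the normal cone under convergence of the curves and of the primitives `N j` of the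
normal vectors: at a differentiability point, the one-sided quadratic estimate is integrated over
a short interval to the right, first `j → ∞`, then the length of the interval tends to `0`. -/
theorem mem_clarkeNormalCone_of_tendsto (hP : P.IsRegular ρ L η M Λ) {κ K : ℝ} (hκ : 0 ≤ κ)
    (hK : 0 ≤ K) {x ν N : ℕ → ℝ → Vec n} {x₀ N₀ : ℝ → Vec n} {R : NNReal}
    (hx : ∀ j, LipschitzOnWith R (x j) (Icc 0 P.T))
    (hN : ∀ j, IsPrimitive P.T (N j) (ν j))
    (hν : ∀ j, ∀ᵐ t ∂P.timeMeasure, ‖ν j t‖ ≤ K ∧ ∀ c ∈ P.C t, ‖c - x j t‖ ≤ ρ / 2 →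
      inner ℝ (ν j t) (c - x j t) ≤ κ * ‖c - x j t‖ ^ 2)
    (hxlim : ∀ t ∈ Icc 0 P.T, Tendsto (fun j => x j t) atTop (𝓝 (x₀ t)))
    (hNlim : ∀ t ∈ Icc 0 P.T, Tendsto (fun j => N j t) atTop (𝓝 (N₀ t)))
    {t : ℝ} (ht : t ∈ Ioo 0 P.T) (hxt : x₀ t ∈ P.C t) {ζ : Vec n} (hζ : HasDerivAt N₀ ζ t) :
    ζ ∈ clarkeNormalCone (P.C t) (x₀ t) := by
  have htI := Ioo_subset_Icc_self ht
  have hρ := hP.ρ_pos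
  refine mem_clarkeNormalCone_of_inner_sub_le (κ := κ) hP.regular hP.ρ_pos hP.ψ_cont hP.η_pos
    hP.inward (δ := ρ / 2) (half_pos hρ) ⟨htI, hxt⟩ fun c hc hcx => ?_
  set a := c - x₀ t with ha
  set d := ‖a‖ with hd
  -- `c` stays in `C(s)` for `s` near `t`
  have hcC : ∀ᶠ s in 𝓝 t, c ∈ P.C s := by
    refine eventually_all.2 fun i => ?_
    have hcont : ContinuousOn (fun s => P.ψ i s c) (Icc 0 P.T) :=
      (hP.ψ_cont i).comp (f := fun s : ℝ => (s, c)) (by fun_prop) fun s hs => ⟨hs, mem_univ _⟩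
    have h1 := (hcont t htI).continuousAt (Icc_mem_nhds ht.1 ht.2)
    exact (h1.tendsto.eventually_lt_const (hc i)).mono fun s hs => hs.le
  obtain ⟨ε, hε, hεC⟩ := Metric.eventually_nhds_iff.1 hcC
  -- the estimate on `[t, t']`, after the passage to the limit in `j`
  have hstep : ∀ t' ∈ Ioo t (min P.T (t + ε)), d + R * (t' - t) < ρ / 2 →
      inner ℝ a (N₀ t' - N₀ t) ≤
        (t' - t) * (κ * (d + R * (t' - t)) ^ 2 + K * (R * (t' - t))) := by
    intro t' ht' hsmall
    have htt' : 0 < t' - t := sub_pos.2 ht'.1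
    have ht'I : t' ∈ Icc 0 P.T :=
      ⟨htI.1.trans ht'.1.le, (ht'.2.trans_le (min_le_left _ _)).le⟩
    have hsub : Icc t t' ⊆ Icc 0 P.T := Icc_subset_Icc htI.1 ht'I.2
    let e : ℕ → ℝ := fun j => ‖x j t - x₀ t‖ + R * (t' - t)
    have he : Tendsto e atTop (𝓝 (R * (t' - t))) := by
      have := (tendsto_iff_norm_sub_tendsto_zero.1 (hxlim t htI)).add_const (R * (t' - t))
      simpa using this
    have hl : Tendsto (fun j => inner ℝ a (N j t' - N j t)) atTop
        (𝓝 (inner ℝ a (N₀ t' - N₀ t))) :=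
      tendsto_const_nhds.inner ((hNlim t' ht'I).sub (hNlim t htI))
    have hr : Tendsto (fun j => (t' - t) * (κ * (d + e j) ^ 2 + K * e j)) atTop
        (𝓝 ((t' - t) * (κ * (d + R * (t' - t)) ^ 2 + K * (R * (t' - t))))) :=
      ((((he.const_add d).pow 2).const_mul κ).add (he.const_mul K)).const_mul _
    refine le_of_tendsto_of_tendsto hl hr ?_
    filter_upwards [(he.const_add d).eventually_lt_const hsmall] with j hj
    have hii := (hN j).intervalIntegrable htI ht'I
    rw [(hN j).sub_eq htI ht'I]
    have h4 := (innerSL ℝ a).intervalIntegral_comp_comm hii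
    simp only [innerSL_apply_apply] at h4
    rw [← h4]
    have hconst : (t' - t) * (κ * (d + e j) ^ 2 + K * e j) =
        ∫ _s in t..t', (κ * (d + e j) ^ 2 + K * e j) := by
      rw [intervalIntegral.integral_const, smul_eq_mul]
    rw [hconst]
    refine intervalIntegral.integral_mono_ae_restrict ht'.1.le
      (((hN j).map (innerSL ℝ a)).intervalIntegrable htI ht'I) intervalIntegrable_const ?_
    filter_upwards [ae_mono (Measure.restrict_mono_set volume hsub) (hν j),
      ae_restrict_mem measurableSet_Icc] with s hs hst
    have hsI := hsub hst
    have hdist : ‖x j s - x₀ t‖ ≤ e j := by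
      have h1 := (hx j).dist_le_mul s hsI t htI
      rw [dist_eq_norm, Real.dist_eq, abs_of_nonneg (sub_nonneg.2 hst.1)] at h1
      have h2 : (R : ℝ) * (s - t) ≤ R * (t' - t) :=
        mul_le_mul_of_nonneg_left (by linarith [hst.2]) R.2
      have h3 := norm_sub_le_norm_sub_add_norm_sub (x j s) (x j t) (x₀ t)
      simp only [e]
      linarith
    have hcs : ‖c - x j s‖ ≤ d + e j := by
      have h1 : c - x j s = a - (x j s - x₀ t) := by rw [ha]; abel
      rw [h1]
      exact (norm_sub_le _ _).trans (by linarith)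
    have hcCs : c ∈ P.C s := by
      refine hεC ?_
      rw [Real.dist_eq, abs_of_nonneg (sub_nonneg.2 hst.1)]
      have := ht'.2.trans_le (min_le_right _ _)
      linarith [hst.2]
    have h1 := hs.2 c hcCs (hcs.trans hj.le)
    have h2 : κ * ‖c - x j s‖ ^ 2 ≤ κ * (d + e j) ^ 2 :=
      mul_le_mul_of_nonneg_left (pow_le_pow_left₀ (norm_nonneg _) hcs 2) hκ
    have h3 : inner ℝ (ν j s) (x j s - x₀ t) ≤ K * e j :=
      (real_inner_le_norm _ _).trans (mul_le_mul hs.1 hdist (norm_nonneg _) hK)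
    have h5 : inner ℝ a (ν j s) = inner ℝ (ν j s) (c - x j s) +
        inner ℝ (ν j s) (x j s - x₀ t) := by
      rw [← inner_add_right, real_inner_comm, ha]
      congr 1; abel
    rw [h5]
    linarith
  have hderiv : HasDerivAt (fun s => inner ℝ a (N₀ s)) (inner ℝ a ζ) t := by
    simpa using! (innerSL ℝ a).hasFDerivAt.comp_hasDerivAt t hζ
  have hslope := (hasDerivAt_iff_tendsto_slope_left_right.1 hderiv).2
  have hrlim : Tendsto (fun s : ℝ => κ * (d + R * (s - t)) ^ 2 + K * (R * (s - t))) (𝓝[>] t)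
      (𝓝 (κ * d ^ 2)) := by
    have : Continuous fun s : ℝ => κ * (d + R * (s - t)) ^ 2 + K * (R * (s - t)) := by fun_prop
    simpa using (this.tendsto t).mono_left nhdsWithin_le_nhds
  have hsmall : ∀ᶠ s in 𝓝[>] t, d + R * (s - t) < ρ / 2 := by
    have hcont : Continuous fun s : ℝ => d + R * (s - t) := by fun_prop
    have h1 : Tendsto (fun s : ℝ => d + R * (s - t)) (𝓝[>] t) (𝓝 d) := by
      simpa using (hcont.tendsto t).mono_left nhdsWithin_le_nhds
    exact h1.eventually_lt_const hcx
  rw [real_inner_comm]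
  refine le_of_tendsto_of_tendsto hslope hrlim ?_
  filter_upwards [hsmall, Ioo_mem_nhdsGT (lt_min ht.2 (by linarith : t < t + ε))] with s hs hst
  rw [slope_def_field, div_le_iff₀ (sub_pos.2 hst.1), ← inner_sub_right, mul_comm]
  exact hstep s hst hs

/-- Compactness of the set of trajectories: a sequence of trajectories with bounded initial values
has a subsequence that converges pointwise to a trajectory. -/
theorem exists_subseq_solvesDynamics (hP : P.IsRegular ρ L η M Λ)
   
    {x : ℕ → ℝ → Vec n} {y : ℕ → ℝ → Vec l} {u : ℕ → ℝ → Vec m}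
    (hu : ∀ j, u j ∈ P.controls) (hsol : ∀ j, P.SolvesDynamics (x j) (y j) (u j))
    {Y : ℝ} (hY : ∀ j, ‖y j 0‖ ≤ Y) :
    ∃ φ : ℕ → ℕ, StrictMono φ ∧ ∃ x₀ y₀, ∃ u₀ ∈ P.controls, P.SolvesDynamics x₀ y₀ u₀ ∧
      (∀ t ∈ Icc 0 P.T, Tendsto (fun j => x (φ j) t) atTop (𝓝 (x₀ t))) ∧
      ∀ t ∈ Icc 0 P.T, Tendsto (fun j => y (φ j) t) atTop (𝓝 (y₀ t)) := by
  have hT := hP.T_pos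
  have hT0 := hT.le
  have h0 : (0 : ℝ) ∈ Icc 0 P.T := ⟨le_rfl, hT0⟩
  have hM := hP.M_pos.le
  have hη := hP.η_pos
  have hL := hP.L_pos
  set K := M + L / η with hK
  have hK0 : 0 ≤ K := by positivity
  choose hxC ν hν hx hy using fun j => hP.exists_normal (hu j) (hsol j)
  have hhbd : ∀ j, ∀ᵐ t ∂P.timeMeasure, ‖P.h t (x j t) (y j t) (u j t)‖ ≤ M := fun j => by
    filter_upwards [hP.h_bound, (hu j).2, ae_mem_Icc] with t hb hut ht
    exact hb _ (hxC j t ht) _ _ hut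
  have hxlip : ∀ j, LipschitzOnWith (M + K).toNNReal (x j) (Icc 0 P.T) := fun j => by
    refine (hx j).lipschitzOnWith ?_ (by positivity)
    filter_upwards [hhbd j, hν j] with t h1 h2
    exact (norm_sub_le _ _).trans (add_le_add ((WithLp.norm_fst_le _ _).trans h1) h2.2)
  have hylip : ∀ j, LipschitzOnWith M.toNNReal (y j) (Icc 0 P.T) := fun j => by
    refine (hy j).lipschitzOnWith ?_ hM
    filter_upwards [hhbd j] with t h1
    exact (WithLp.norm_snd_le _ _).trans h1
  have hfin : IsFiniteMeasure P.timeMeasure := by unfold timeMeasure; infer_instance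
  let z : ℕ → ℝ → WithLp 2 (Vec n × Vec l) := fun j t =>
    ∫ s in (0 : ℝ)..t, P.h s (x j s) (y j s) (u j s)
  have hz0 : ∀ j, z j 0 = 0 := fun j => intervalIntegral.integral_same
  have hz : ∀ j, IsPrimitive P.T (z j) (fun t => P.h t (x j t) (y j t) (u j t)) := fun j => by
    refine ⟨Integrable.of_bound (hP.aemeasurable_h (hxlip j).continuousOn (hylip j).continuousOn
      (hxC j) (hu j)).aestronglyMeasurable M (hhbd j), fun t _ => ?_⟩
    rw [hz0, zero_add]
  have hzlip : ∀ j, LipschitzOnWith M.toNNReal (z j) (Icc 0 P.T) := fun j =>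
    (hz j).lipschitzOnWith (hhbd j) hM
  have hgrow : ∀ {F : Type} [NormedAddCommGroup F] (w : ℝ → F),
      LipschitzOnWith M.toNNReal w (Icc 0 P.T) → ∀ t ∈ Icc 0 P.T, ‖w t‖ ≤ ‖w 0‖ + M * P.T := by
    intro F _ w hw t ht
    have h1 := hw.dist_le_mul t ht 0 h0
    rw [dist_eq_norm, Real.coe_toNNReal _ hM, Real.dist_eq, sub_zero, abs_of_nonneg ht.1] at h1
    have h2 := mul_le_mul_of_nonneg_left ht.2 hM
    have h3 := norm_le_norm_add_norm_sub' (w t) (w 0)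
    linarith
  obtain ⟨B, hB⟩ := isBounded_iff_forall_norm_le.1 hP.bounded
  obtain ⟨φ, hφ, G, hG, hlim⟩ := exists_subseq_tendsto_of_lipschitzOnWith
    (F := fun j t => (x j t, y j t, z j t)) (R := max B (max (Y + M * P.T) (M * P.T))) hT0
    (fun j => (hxlip j).prodMk ((hylip j).prodMk (hzlip j))) (fun j t ht => by
      refine max_le_max ((norm_snd_le (t, x j t)).trans (hB _ ⟨ht, hxC j t ht⟩))
        (max_le_max ?_ ?_)
      · have := hgrow _ (hylip j) t ht
        have := hY j
        linarith
      · have := hgrow _ (hzlip j) t ht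
        rwa [hz0, norm_zero, zero_add] at this)
  let x₀ : ℝ → Vec n := fun t => (G t).1
  let y₀ : ℝ → Vec l := fun t => (G t).2.1
  let z₀ : ℝ → WithLp 2 (Vec n × Vec l) := fun t => (G t).2.2
  have hxlim : ∀ t ∈ Icc 0 P.T, Tendsto (fun j => x (φ j) t) atTop (𝓝 (x₀ t)) := fun t ht =>
    (continuous_fst.tendsto _).comp (hlim t ht)
  have hylim : ∀ t ∈ Icc 0 P.T, Tendsto (fun j => y (φ j) t) atTop (𝓝 (y₀ t)) := fun t ht =>
    ((continuous_fst.comp continuous_snd).tendsto _).comp (hlim t ht)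
  have hzlim : ∀ t ∈ Icc 0 P.T, Tendsto (fun j => z (φ j) t) atTop (𝓝 (z₀ t)) := fun t ht =>
    ((continuous_snd.comp continuous_snd).tendsto _).comp (hlim t ht)
  have hx₀lip := LipschitzWith.prod_fst.comp_lipschitzOnWith hG
  have hyz₀lip := LipschitzWith.prod_snd.comp_lipschitzOnWith hG
  have hy₀lip := LipschitzWith.prod_fst.comp_lipschitzOnWith hyz₀lip
  have hz₀lip := LipschitzWith.prod_snd.comp_lipschitzOnWith hyz₀lip
  have hx₀c : ContinuousOn x₀ (Icc 0 P.T) := hx₀lip.continuousOn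
  have hy₀c : ContinuousOn y₀ (Icc 0 P.T) := hy₀lip.continuousOn
  obtain ⟨hx₀int, hx₀eq, hx₀d⟩ := eq_add_integral_deriv_of_lipschitzOnWith (f := x₀) hT0 hx₀lip
  obtain ⟨hz₀int, hz₀eq, hz₀d⟩ := eq_add_integral_deriv_of_lipschitzOnWith (f := z₀) hT0 hz₀lip
  have hz₀prim : IsPrimitive P.T z₀ (deriv z₀) := ⟨hz₀int, hz₀eq⟩
  have hx₀C : ∀ t ∈ Icc 0 P.T, x₀ t ∈ P.C t := fun t ht =>
    (isClosed_C hP.ψ_cont ht).mem_of_tendsto (hxlim t ht)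
      (Eventually.of_forall fun j => hxC (φ j) t ht)
  have hmem := hP.ae_mem_image (fun j => (hxlip (φ j)).continuousOn)
    (fun j => (hylip (φ j)).continuousOn) hx₀c hy₀c (fun j => hxC (φ j)) hx₀C (fun j => hu (φ j))
    hxlim hylim hzlim hz₀prim
  obtain ⟨u₀, hu₀, hu₀eq⟩ := exists_control_eq hP.ψ_cont hP.mem_closure hP.h_meas hP.h_cont
    hP.U_meas hP.U_compact hx₀c hy₀c hx₀C hz₀int.aestronglyMeasurable.aemeasurable hmem
  refine ⟨φ, hφ, x₀, y₀, u₀, hu₀, ⟨deriv x₀, fun t => P.g t (x₀ t) (y₀ t) (u₀ t),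
    ⟨hx₀int, hx₀eq⟩, ?_, ?_, Eventually.of_forall fun _ => rfl⟩, hxlim, hylim⟩
  · -- `y₀` differs from the second component of `z₀` by a constant
    have hyz : ∀ j, ∀ t ∈ Icc 0 P.T, y j t = y j 0 + (z j t).snd := by
      intro j t ht
      have h1 := ((hz j).map (WithLp.sndL 2 ℝ (Vec n) (Vec l))).2 t ht
      simp only [hz0, map_zero, zero_add] at h1
      rw [(hy j).2 t ht]
      exact congrArg (y j 0 + ·) h1.symm
    have hyz₀ : ∀ t ∈ Icc 0 P.T, y₀ t = y₀ 0 + (z₀ t).snd := by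
      intro t ht
      refine tendsto_nhds_unique (hylim t ht) ?_
      have h1 := (hylim 0 h0).add
        (((WithLp.sndL 2 ℝ (Vec n) (Vec l)).continuous.tendsto _).comp (hzlim t ht))
      exact h1.congr fun j => (hyz (φ j) t ht).symm
    have hz₀0 : z₀ 0 = 0 := by
      refine tendsto_nhds_unique (hzlim 0 h0) ?_
      simp only [hz0]
      exact tendsto_const_nhds
    have hsnd := hz₀prim.map (WithLp.sndL 2 ℝ (Vec n) (Vec l))
    have hprim : IsPrimitive P.T y₀ (fun t => (deriv z₀ t).snd) := by
      refine ⟨hsnd.1, fun t ht => ?_⟩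
      have h1 := hsnd.2 t ht
      simp only [hz₀0, map_zero, zero_add] at h1
      rw [hyz₀ t ht]
      exact congrArg (y₀ 0 + ·) h1
    refine hprim.congr_ae ?_
    filter_upwards [hu₀eq] with t ht
    rw [← ht]; rfl
  · have hN : ∀ j, IsPrimitive P.T (fun t => (z j t).fst - x j t) (ν j) := by
      intro j
      have h1 := ((hz j).map (WithLp.fstL 2 ℝ (Vec n) (Vec l))).sub (hx j)
      refine h1.congr_ae (Eventually.of_forall fun t => ?_)
      exact sub_sub_cancel _ _
    have hNlim : ∀ t ∈ Icc 0 P.T, Tendsto (fun j => (z (φ j) t).fst - x (φ j) t) atTop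
        (𝓝 ((z₀ t).fst - x₀ t)) := fun t ht =>
      (((WithLp.fstL 2 ℝ (Vec n) (Vec l)).continuous.tendsto _).comp (hzlim t ht)).sub (hxlim t ht)
    have hquad : ∀ j, ∀ᵐ t ∂P.timeMeasure, ‖ν j t‖ ≤ K ∧ ∀ c ∈ P.C t, ‖c - x j t‖ ≤ ρ / 2 →
        inner ℝ (ν j t) (c - x j t) ≤ L / η * K * ‖c - x j t‖ ^ 2 := by
      intro j
      filter_upwards [hν j, ae_mem_Icc] with t h1 ht
      refine ⟨h1.2, fun c hc hcx => ?_⟩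
      obtain ⟨v, hv⟩ := hP.inward (t, x j t) ⟨ht, hxC j t ht⟩
      have h2 := inner_sub_le_of_mem_clarkeNormalCone hP.regular hP.ρ_pos hL.le hP.ψ_cont hη ht hv
        h1.1 hc hcx
      have h3 : L * ‖c - x j t‖ ^ 2 / η * ‖ν j t‖ ≤ L * ‖c - x j t‖ ^ 2 / η * K :=
        mul_le_mul_of_nonneg_left h1.2 (by positivity)
      calc _ ≤ _ := h2.trans h3
        _ = _ := by ring
    have hIoo : ∀ᵐ t ∂P.timeMeasure, t ∈ Ioo 0 P.T := by
      rw [timeMeasure, ← Measure.restrict_congr_set Ioo_ae_eq_Icc]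
      exact ae_restrict_mem measurableSet_Ioo
    filter_upwards [hu₀eq, hx₀d, hz₀d, hIoo] with t ht hxd hzd htI
    have hζ : HasDerivAt (fun t => (z₀ t).fst - x₀ t)
        (P.f t (x₀ t) (y₀ t) (u₀ t) - deriv x₀ t) t := by
      have h1 := ((WithLp.fstL 2 ℝ (Vec n) (Vec l)).hasFDerivAt.comp_hasDerivAt t hzd).sub hxd
      rw [← ht] at h1
      exact h1
    refine ⟨_, hP.mem_clarkeNormalCone_of_tendsto (κ := L / η * K) (by positivity) hK0
      (fun j => hxlip (φ j)) (fun j => hN (φ j)) (fun j => hquad (φ j)) hxlim hNlim htI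
      (hx₀C t (Ioo_subset_Icc_self htI)) hζ, ?_⟩
    abel

/-- The set of endpoints of admissible pairs is compact. -/
theorem isCompact_endpoints (hP : P.IsRegular ρ L η M Λ) (hS : IsClosed P.S)
    (hSb : Bornology.IsBounded ((fun p => p.2.1) '' P.S)) :
    IsCompact {p | ∃ x y u, P.Admissible x y u ∧ P.endpoints x y = p} := by
  refine IsSeqCompact.isCompact fun p hp => ?_
  choose x y u hadm hend using hp
  obtain ⟨Y, hY⟩ := isBounded_iff_forall_norm_le.1 hSb
  obtain ⟨φ, hφ, x₀, y₀, u₀, hu₀, hsol, hxlim, hylim⟩ := hP.exists_subseq_solvesDynamics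
    (fun j => (hadm j).1) (fun j => (hadm j).2.1) (Y := Y)
    fun j => hY _ ⟨_, (hadm j).2.2, rfl⟩
  have h0 : (0 : ℝ) ∈ Icc 0 P.T := ⟨le_rfl, hP.T_pos.le⟩
  have hT : P.T ∈ Icc 0 P.T := ⟨hP.T_pos.le, le_rfl⟩
  have hlim : Tendsto (p ∘ φ) atTop (𝓝 (P.endpoints x₀ y₀)) := by
    have h1 : Tendsto (fun j => P.endpoints (x (φ j)) (y (φ j))) atTop
        (𝓝 (P.endpoints x₀ y₀)) :=
      (hxlim 0 h0).prodMk_nhds ((hylim 0 h0).prodMk_nhds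
        ((hxlim P.T hT).prodMk_nhds (hylim P.T hT)))
    exact h1.congr fun j => hend (φ j)
  refine ⟨_, ⟨x₀, y₀, u₀, ⟨hu₀, hsol, ?_⟩, rfl⟩, φ, hφ, hlim⟩
  exact hS.mem_of_tendsto hlim (Eventually.of_forall fun j => by
    have := (hadm (φ j)).2.2
    rwa [hend] at this)

end IsRegular

/-- The constants of the standing hypotheses exist. -/
theorem exists_isRegular (hT : 0 < P.T) (hU_meas : P.MeasurableControlSets)
    (hU_compact : ∀ t ∈ Icc 0 P.T, IsCompact (P.U t))
    (hψ_cont : ∀ i, ContinuousOn (fun q : ℝ × Vec n => P.ψ i q.1 q.2) (Icc 0 P.T ×ˢ univ))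
    (hψ_reg : P.RegularGenerators) (hψ_cq : P.ConstraintQualification)
    (hh_reg : P.RegularDynamics) (hh_convex : P.ConvexVelocities)
    (hC_bdd : Bornology.IsBounded P.graphC) :
    ∃ ρ L η M Λ, P.IsRegular ρ L η M Λ := by
  obtain ⟨ρ, hρ, L, hL, hreg⟩ := hψ_reg
  have hreg : P.RegularWith ρ L := hreg
  obtain ⟨η, hη, hin⟩ := exists_isInward hreg hρ hψ_cont hC_bdd hψ_cq
  obtain ⟨-, hmeas, hcont, M, hM, Λ, -, -, hbl⟩ := hh_reg
  refine ⟨ρ, L, η, M, Λ, ?_⟩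
  exact
    { T_pos := hT
      ρ_pos := hρ
      L_pos := hL
      η_pos := hη
      M_pos := hM
      ψ_cont := hψ_cont
      regular := hreg
      bounded := hC_bdd
      inward := hin
      U_meas := hU_meas
      U_compact := hU_compact
      h_meas := hmeas
      h_cont := hcont
      h_bound := hbl.mono fun t h x hx y u hu => (h x hx y x hx y u hu).1
      h_lip := hbl.mono fun t h x hx y x₁ hx₁ y₁ u hu => (h x hx y x₁ hx₁ y₁ u hu).2
      h_convex := hh_convex }

end Problem

end SweepingControl

theorem theorem2p3 {n l m r : ℕ} (P : SweepingControl.Problem n l m r)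
    (hT : 0 < P.T)
    (hS_closed : IsClosed P.S)
    (hS_sub : ∀ p ∈ P.S, p.1 ∈ P.C 0)
    (hU_nonempty : ∀ t ∈ Set.Icc 0 P.T, (P.U t).Nonempty)
    (hU_meas : P.MeasurableControlSets)
    (hU_compact : ∀ t ∈ Set.Icc 0 P.T, IsCompact (P.U t))
    (hψ_cont : ∀ i, ContinuousOn (fun q : ℝ × SweepingControl.Vec n => P.ψ i q.1 q.2)
      (Set.Icc 0 P.T ×ˢ Set.univ))
    (hC_nonempty : ∀ t ∈ Set.Icc 0 P.T, (P.C t).Nonempty)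
    (hψ_reg : P.RegularGenerators)
    (hψ_cq : P.ConstraintQualification)
    (hh_reg : P.RegularDynamics)
    (hh_convex : P.ConvexVelocities)
    (hC_bdd : Bornology.IsBounded P.graphC)
    (hS_bdd : Bornology.IsBounded ((fun p => p.2.1) '' P.S))
    (hJ_lsc : LowerSemicontinuous P.J) :
    (∃ x y u, P.IsGlobalOptimal x y u) ↔
      ∃ x y u, P.Admissible x y u ∧ P.endpoints x y ∈ P.domJ := by
  constructor
  · rintro ⟨x, y, u, hadm, hdom, -⟩
    exact ⟨x, y, u, hadm, hdom⟩
  · rintro ⟨x, y, u, hadm, hdom⟩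
    obtain ⟨ρ, L, η, M, Λ, hP⟩ := SweepingControl.Problem.exists_isRegular hT hU_meas hU_compact
      hψ_cont hψ_reg hψ_cq hh_reg hh_convex hC_bdd
    have hne : {p | ∃ x y u, P.Admissible x y u ∧ P.endpoints x y = p}.Nonempty :=
      ⟨P.endpoints x y, x, y, u, hadm, rfl⟩
    obtain ⟨_, ⟨x₀, y₀, u₀, hadm₀, rfl⟩, hmin⟩ := LowerSemicontinuousOn.exists_isMinOn hne
      (hP.isCompact_endpoints hS_closed hS_bdd)
      (hJ_lsc.lowerSemicontinuousOn _)
    have hle : ∀ x₁ y₁ u₁, P.Admissible x₁ y₁ u₁ →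
        P.J (P.endpoints x₀ y₀) ≤ P.J (P.endpoints x₁ y₁) := fun x₁ y₁ u₁ h₁ =>
      hmin ⟨x₁, y₁, u₁, h₁, rfl⟩
    exact ⟨x₀, y₀, u₀, hadm₀, (hle x y u hadm).trans_lt hdom, hle⟩
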